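/- **Theorem (conditional gradient for the linear Arrow–Debreu Nash bargaining matching market).** Let $n\ge 1$, let $u_{ij}\ge 0$ ($i,j\in\{1,\dots,n\}$) be the utility of agent $i$ for good $j$, and let $c_i\in\mathbb R$ be the disagreement utilities. Let $P$ be the set of all $x\in\mathbb R_{\ge0}^{n\times n}$ with $\sum_i x_{ij}\le 1$ for all $j$ and $\sum_j x_{ij}\le 1$ for all $i$, and put $u_i(x)=\sum_j u_{ij}x_{ij}$. Assume that the utilities are scaled so that $\max_j u_{ij}=1$ for every $i$, that $\kappa>0$ satisfies $\sum_j u_{ij}\ge 1/\kappa$ for every $i$, and that $\delta>0$ is a feasibility gap: some $\hat x\in P$ satisfies $u_i(\hat x)\ge(1+\delta)c_i$ for every $i$. For $z_0>0$ let $$\eta(z;z_0)=\begin{cases}\log z_0+\dfrac{z-z_0}{z_0}-\dfrac{(z-z_0)^2}{2z_0^2}&\text{if } z\le z_0,\\[1ex] \log z&\text{if } z>z_0,\end{cases}$$ and let $\psi(x)=\sum_i\eta\!\left(u_i(x)-c_i;\ \dfrac{1}{2n^2(1+1/\delta)\kappa}\right)$. The conditional gradient algorithm starts with $x^{(0)}=0$.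 In iteration $t=1,\dots,T$ it computes the weights $w^{(t)}_{ij}=\partial\psi/\partial x_{ij}\,(x^{(t-1)})$, takes a matching of agents and goods of maximum total weight for $w^{(t)}$ (ties broken arbitrarily) with incidence matrix $y^{(t)}\in\{0,1\}^{n\times n}$, and sets $x^{(t)}=\bigl(1-\tfrac{2}{t+1}\bigr)x^{(t-1)}+\tfrac{2}{t+1}y^{(t)}$. It returns $x^{(T)}$. 1. $\psi$ has a maximiser over $P$. There is an absolute constant $C$ such that for all such instances, every $\varepsilon>0$ and every integer $T\ge\bigl\lfloor C\,n^5(1+1/\delta)^2\kappa^2/\varepsilon\bigr\rfloor$, every run of the algorithm with $T$ iterations returns a point $x\in P$ with $\psi(x^*)-\psi(x)\le\varepsilon$ for every maximiser $x^*$ of $\psi$ over $P$. That is, $O\!\left(n^5(1+1/\delta)^2\kappa^2/\varepsilon\right)$ iterations suffice. 2. Each iteration can be implemented in $O(n^3)$ time on a real random access machine (unit-cost exact arithmetic $+,-,\times,/$ and comparison on reals; unit-cost addition, truncated subtraction and comparison on integers; unit-cost access to arrays). Precisely, there are one program and one constant $C'$ such that for every such instance, every $t\ge1$ and every $x\in P$,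 the program, started with $n,u,c,\delta,\kappa,t,x$ in memory (all other memory being arbitrary), halts after at most $C'n^3$ time units with $n,u,c,\delta,\kappa,t+1,x'$ in the same places, where $x'$ is a possible result of iteration $t$ applied to $x^{(t-1)}=x$. -/

import Mathlib

noncomputable section

/-! ### A real random access machine, programmed in a structured language

Memory consists of integer arrays (cells hold natural numbers) and two-dimensional real arrays
(cells hold exact real numbers). Arrays are named by natural numbers that are fixed in the program.
Every arithmetic operation, memory access, comparison, assignment and branch costs one time unit.
There is neither rounding of reals nor multiplication or division of integers. -/

namespace RealRAM

/-- Memory: `int a i` is the cell `a[i]`, and `real a i j` is the cell `a[i, j]`. -/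
structure State where
  int : ℕ → ℕ → ℕ
  real : ℕ → ℕ → ℕ → ℝ

/-- Integer expressions; `sub` is truncated subtraction. -/
inductive IntExpr where
  | const (k : ℕ)
  | cell (a : ℕ) (i : IntExpr)
  | add (e f : IntExpr)
  | sub (e f : IntExpr)

namespace IntExpr

/-- The value of an integer expression. -/
def eval (s : State) : IntExpr → ℕ
  | const k => k
  | cell a i => s.int a (i.eval s)
  | add e f => e.eval s + f.eval s
  | sub e f => e.eval s - f.eval s

/-- The time needed to evaluate an integer expression. -/
def cost : IntExpr → ℕ
  | const _ => 1
  | cell _ i => i.cost + 1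
  | add e f => e.cost + f.cost + 1
  | sub e f => e.cost + f.cost + 1

end IntExpr

/-- Real expressions; `ofInt` reads an integer as a real number. -/
inductive RealExpr where
  | ofInt (e : IntExpr)
  | cell (a : ℕ) (i j : IntExpr)
  | add (e f : RealExpr)
  | sub (e f : RealExpr)
  | mul (e f : RealExpr)
  | div (e f : RealExpr)

namespace RealExpr

/-- The value of a real expression. -/
def eval (s : State) : RealExpr → ℝ
  | ofInt e => (e.eval s : ℝ)
  | cell a i j => s.real a (i.eval s) (j.eval s)
  | add e f => e.eval s + f.eval s
  | sub e f => e.eval s - f.eval s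
  | mul e f => e.eval s * f.eval s
  | div e f => e.eval s / f.eval s

/-- The time needed to evaluate a real expression. -/
def cost : RealExpr → ℕ
  | ofInt e => e.cost + 1
  | cell _ i j => i.cost + j.cost + 1
  | add e f => e.cost + f.cost + 1
  | sub e f => e.cost + f.cost + 1
  | mul e f => e.cost + f.cost + 1
  | div e f => e.cost + f.cost + 1

end RealExpr

/-- Boolean tests. -/
inductive Test where
  | intLE (e f : IntExpr)
  | realLE (e f : RealExpr)
  | neg (b : Test)
  | and (b c : Test)

namespace Test

/-- The truth value of a test. -/
def Holds (s : State) : Test → Prop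
  | intLE e f => e.eval s ≤ f.eval s
  | realLE e f => e.eval s ≤ f.eval s
  | neg b => ¬ b.Holds s
  | and b c => b.Holds s ∧ c.Holds s

/-- The time needed to evaluate a test. -/
def cost : Test → ℕ
  | intLE e f => e.cost + f.cost + 1
  | realLE e f => e.cost + f.cost + 1
  | neg b => b.cost + 1
  | and b c => b.cost + c.cost + 1

end Test

/-- Programs: assignment to one memory cell, sequencing, branching and while-loops. -/
inductive Prog where
  | setInt (a : ℕ) (i e : IntExpr)
  | setReal (a : ℕ) (i j : IntExpr) (e : RealExpr)
  | seq (p q : Prog)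
  | ite (b : Test) (p q : Prog)
  | while (b : Test) (p : Prog)

/-- The memory after `a[i] := v` for an integer cell. -/
def State.writeInt (s : State) (a i v : ℕ) : State where
  int := fun a' i' => if a' = a ∧ i' = i then v else s.int a' i'
  real := s.real

/-- The memory after `a[i, j] := v` for a real cell. -/
def State.writeReal (s : State) (a i j : ℕ) (v : ℝ) : State where
  int := s.int
  real := fun a' i' j' => if a' = a ∧ i' = i ∧ j' = j then v else s.real a' i' j'

/-- `Exec p s s' k`: the program `p`, started in memory `s`, halts in memory `s'` after exactly
`k` time units. -/
inductive Exec : Prog → State → State → ℕ → Prop where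
  | setInt (a : ℕ) (i e : IntExpr) (s : State) :
      Exec (.setInt a i e) s (s.writeInt a (i.eval s) (e.eval s)) (i.cost + e.cost + 1)
  | setReal (a : ℕ) (i j : IntExpr) (e : RealExpr) (s : State) :
      Exec (.setReal a i j e) s (s.writeReal a (i.eval s) (j.eval s) (e.eval s))
        (i.cost + j.cost + e.cost + 1)
  | seq {p q : Prog} {s s' s'' : State} {k l : ℕ} :
      Exec p s s' k → Exec q s' s'' l → Exec (.seq p q) s s'' (k + l)
  | ite_true {b : Test} {p : Prog} (q : Prog) {s s' : State} {k : ℕ} :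
      b.Holds s → Exec p s s' k → Exec (.ite b p q) s s' (b.cost + k + 1)
  | ite_false {b : Test} (p : Prog) {q : Prog} {s s' : State} {k : ℕ} :
      ¬ b.Holds s → Exec q s s' k → Exec (.ite b p q) s s' (b.cost + k + 1)
  | while_true {b : Test} {p : Prog} {s s' s'' : State} {k l : ℕ} :
      b.Holds s → Exec p s s' k → Exec (.while b p) s' s'' l →
      Exec (.while b p) s s'' (b.cost + k + l + 1)
  | while_false {b : Test} (p : Prog) {s : State} :
      ¬ b.Holds s → Exec (.while b p) s s (b.cost + 1)

end RealRAM

/-! ### The linear Arrow-Debreu Nash bargaining one-sided matching market -/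

/-- The quadratic extension of the logarithm below `z₀ > 0`. -/
def quadLog (z₀ z : ℝ) : ℝ :=
  if z ≤ z₀ then Real.log z₀ + (z - z₀) * (1 / z₀) - 1 / 2 * (z - z₀) ^ 2 * (1 / z₀ ^ 2)
  else Real.log z

/-- The data of an instance with `n` agents and `n` goods: utilities `u i j` of agent `i` for good
`j`, disagreement utilities `c i`, feasibility gap `δ`, and scaling parameter `κ`. -/
structure LiAD (n : ℕ) where
  u : Matrix (Fin n) (Fin n) ℝ
  c : Fin n → ℝ
  δ : ℝ
  κ : ℝ

/-- The fractional matchings: nonnegative matrices with all row and column sums at most one. -/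
def allocations (n : ℕ) : Set (Matrix (Fin n) (Fin n) ℝ) :=
  {x | (∀ i j, 0 ≤ x i j) ∧ (∀ j, ∑ i, x i j ≤ 1) ∧ ∀ i, ∑ j, x i j ≤ 1}

/-- `y` is the incidence matrix of a matching between agents and goods. -/
def IsMatchingMatrix {n : ℕ} (y : Matrix (Fin n) (Fin n) ℝ) : Prop :=
  y ∈ allocations n ∧ ∀ i j, y i j = 0 ∨ y i j = 1

/-- `y` is a matching of maximum weight for the edge weights `w`. -/
def IsMaxWeightMatching {n : ℕ} (w y : Matrix (Fin n) (Fin n) ℝ) : Prop :=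
  IsMatchingMatrix y ∧
    ∀ z, IsMatchingMatrix z → ∑ i, ∑ j, w i j * z i j ≤ ∑ i, ∑ j, w i j * y i j

namespace LiAD

variable {n : ℕ} (M : LiAD n)

/-- The utility of agent `i` under the allocation `x`. -/
def utility (x : Matrix (Fin n) (Fin n) ℝ) (i : Fin n) : ℝ := ∑ j, M.u i j * x i j

/-- The assumptions on an instance: nonnegative utilities, scaled so that every agent's largest
utility is one, `κ > 0` with `∑ j, u i j ≥ 1 / κ`, and `δ > 0` is a feasibility gap. -/
structure IsValid : Prop where
  u_nonneg : ∀ i j, 0 ≤ M.u i j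
  u_max : ∀ i, IsGreatest (Set.range (M.u i)) 1
  κ_pos : 0 < M.κ
  u_sum : ∀ i, 1 / M.κ ≤ ∑ j, M.u i j
  δ_pos : 0 < M.δ
  feasible : ∃ x ∈ allocations n, ∀ i, (1 + M.δ) * M.c i ≤ M.utility x i

/-- The modified objective. -/
def ψ (x : Matrix (Fin n) (Fin n) ℝ) : ℝ :=
  ∑ i, quadLog (1 / (2 * (n : ℝ) ^ 2 * (1 + 1 / M.δ) * M.κ)) (M.utility x i - M.c i)

/-- `x` is an optimum of the modified convex program. -/
def IsOptimum (x : Matrix (Fin n) (Fin n) ℝ) : Prop :=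
  x ∈ allocations n ∧ IsMaxOn M.ψ (allocations n) x

/-- The matrix of the partial derivatives of the modified objective with respect to `x i j`. -/
def grad (x : Matrix (Fin n) (Fin n) ℝ) : Matrix (Fin n) (Fin n) ℝ :=
  Matrix.of fun i j => lineDeriv ℝ M.ψ x (Matrix.single i j 1)

/-- `x'` is obtained from `x` by iteration number `t` of the conditional gradient algorithm; ties
between matchings of maximum weight may be broken in any way. -/
def IsIteration (t : ℕ) (x x' : Matrix (Fin n) (Fin n) ℝ) : Prop :=
  ∃ y, IsMaxWeightMatching (M.grad x) y ∧
    x' = (1 - 2 / ((t : ℝ) + 1)) • x + (2 / ((t : ℝ) + 1)) • y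

/-- `x 0, …, x T` are the iterates of a run of the conditional gradient algorithm with `T`
iterations, which starts at zero and returns `x T`. -/
def IsRun (T : ℕ) (x : ℕ → Matrix (Fin n) (Fin n) ℝ) : Prop :=
  x 0 = 0 ∧ ∀ t < T, M.IsIteration (t + 1) (x t) (x (t + 1))

/-- The memory `s` holds the instance, the number `t` of the iteration to be executed next, and the
current iterate `x`; nothing is said about the other cells. -/
structure Stored (s : RealRAM.State) (t : ℕ) (x : Matrix (Fin n) (Fin n) ℝ) : Prop where
  n_eq : s.int 0 0 = n
  t_eq : s.int 1 0 = t
  u_eq : ∀ i j : Fin n, s.real 0 i j = M.u i j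
  c_eq : ∀ i : Fin n, s.real 1 i 0 = M.c i
  δ_eq : s.real 2 0 0 = M.δ
  κ_eq : s.real 3 0 0 = M.κ
  x_eq : ∀ i j : Fin n, s.real 4 i j = x i j

end LiAD

end

/-! ### Reasoning about programs of the real random access machine -/

namespace RealRAM

/-! Convergence is the Frank–Wolfe argument. Let z₀ be the threshold. The function η is concave and
η' is Lipschitz with constant 1/z₀², so ψ lies below its tangents and falls short of them by at most
a quadratic term. Utilities on P lie in [0, 1], hence moving by the fraction γ between points of P
loses at most γ²B/2 against the linear prediction, with B = n/z₀² (`curvature`). All weights are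
nonnegative because η' > 0, so by Birkhoff–von Neumann a maximum weight matching maximises the
linearisation over all of P (`IsMaxWeightMatching.le`). The gap h to any point of P therefore
satisfies h_t ≤ (1 − γ)h_{t−1} + γ²B/2, and γ = 2/(t+1) gives h_t ≤ 2B/(t+1), where 2B =
8n⁵(1+1/δ)²κ². The induction starts at h_0 ≤ 2B, which rests on c_i ≤ 1 and z₀ ≤ 1/2. A maximiser
exists by compactness.

For the running time, the weights are u_ij scaled by one slope per row, computable in O(n²), and a
matching is found by the Hungarian algorithm. Rows are inserted one at a time while dual feasible
potentials p, q keep the matched edges tight. A phase runs Dijkstra's search with the reduced costs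
p_i + q_j − w_ij ≥ 0 from the new row to the first free column, shifts the potentials so that the
search forest becomes tight (`Settling.augment`), and flips the path (`Augment.step`). It settles at
most n + 1 columns at O(n) each, so n phases cost O(n³). The final tight matching is optimal by
linear programming duality (`isMaxWeightMatching_of_potentials`).

Programs are verified by total-correctness triples with a time bound (`Runs`): invariants for loops,
weakest preconditions for loop-free code, and a syntactic frame rule for untouched arrays. -/

@[simp] theorem State.int_writeInt (s : State) (a i v b j : ℕ) :
    (s.writeInt a i v).int b j = if b = a ∧ j = i then v else s.int b j := rfl

@[simp] theorem State.real_writeInt (s : State) (a i v : ℕ) :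
    (s.writeInt a i v).real = s.real := rfl

@[simp] theorem State.int_writeReal (s : State) (a i j : ℕ) (v : ℝ) :
    (s.writeReal a i j v).int = s.int := rfl

@[simp] theorem State.real_writeReal (s : State) (a i j : ℕ) (v : ℝ) (b i' j' : ℕ) :
    (s.writeReal a i j v).real b i' j' =
      if b = a ∧ i' = i ∧ j' = j then v else s.real b i' j' := rfl

/-- Started in memory `s`, the program `p` halts within `K` time units in a memory satisfying
`Q`. -/
def Runs (p : Prog) (s : State) (K : ℕ) (Q : State → Prop) : Prop :=
  ∃ s' k, Exec p s s' k ∧ k ≤ K ∧ Q s'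

namespace Prog

/-- Whether `p` contains an assignment to the integer array `a`. -/
def writesInt (a : ℕ) : Prog → Bool
  | setInt b _ _ => b == a
  | setReal _ _ _ _ => false
  | seq p q => p.writesInt a || q.writesInt a
  | ite _ p q => p.writesInt a || q.writesInt a
  | .while _ p => p.writesInt a

/-- Whether `p` contains an assignment to the real array `a`. -/
def writesReal (a : ℕ) : Prog → Bool
  | setInt _ _ _ => false
  | setReal b _ _ _ => b == a
  | seq p q => p.writesReal a || q.writesReal a
  | ite _ p q => p.writesReal a || q.writesReal a
  | .while _ p => p.writesReal a

end Prog

/-- The memories `s` and `s'` agree on all arrays to which `p` does not write. -/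
structure Frame (p : Prog) (s s' : State) : Prop where
  int : ∀ a, p.writesInt a = false → s'.int a = s.int a
  real : ∀ a, p.writesReal a = false → s'.real a = s.real a

theorem Frame.refl (p : Prog) (s : State) : Frame p s s := ⟨fun _ _ => rfl, fun _ _ => rfl⟩

theorem Frame.trans {p : Prog} {s s' s'' : State} (h : Frame p s s') (h' : Frame p s' s'') :
    Frame p s s'' :=
  ⟨fun a ha => (h'.int a ha).trans (h.int a ha), fun a ha => (h'.real a ha).trans (h.real a ha)⟩

theorem Frame.mono {p q : Prog} {s s' : State} (h : Frame p s s')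
    (hi : ∀ a, q.writesInt a = false → p.writesInt a = false)
    (hr : ∀ a, q.writesReal a = false → p.writesReal a = false) : Frame q s s' :=
  ⟨fun a ha => h.int a (hi a ha), fun a ha => h.real a (hr a ha)⟩

/-- The frame condition is syntactic, so for a concrete program `rfl` shows that an array is
unchanged; invariants need only mention arrays that are written. -/
theorem Exec.frame {p : Prog} {s s' : State} {k : ℕ} (h : Exec p s s' k) : Frame p s s' := by
  induction h with
  | setInt a i e s =>
    refine ⟨fun b hb => ?_, fun b hb => rfl⟩
    have : b ≠ a := by rintro rfl; simp [Prog.writesInt] at hb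
    funext j; simp [this]
  | setReal a i j e s =>
    refine ⟨fun b hb => rfl, fun b hb => ?_⟩
    have : b ≠ a := by rintro rfl; simp [Prog.writesReal] at hb
    funext i j; simp [this]
  | seq _ _ h1 h2 =>
    exact (h1.mono (by simp +contextual [Prog.writesInt])
      (by simp +contextual [Prog.writesReal])).trans
      (h2.mono (by simp +contextual [Prog.writesInt]) (by simp +contextual [Prog.writesReal]))
  | ite_true _ _ _ h1 =>
    exact h1.mono (by simp +contextual [Prog.writesInt]) (by simp +contextual [Prog.writesReal])
  | ite_false _ _ _ h1 =>
    exact h1.mono (by simp +contextual [Prog.writesInt]) (by simp +contextual [Prog.writesReal])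
  | while_true _ _ _ h1 h2 =>
    exact (h1.mono (by simp +contextual [Prog.writesInt])
      (by simp +contextual [Prog.writesReal])).trans h2
  | while_false _ _ => exact Frame.refl _ _

namespace Runs

variable {p q : Prog} {s : State} {K K' L : ℕ} {Q Q' : State → Prop} {b : Test}

theorem mono (h : Runs p s K Q) (hK : K ≤ K') (hQ : ∀ s', Q s' → Q' s') : Runs p s K' Q' := by
  obtain ⟨s', k, he, hk, hq⟩ := h
  exact ⟨s', k, he, hk.trans hK, hQ s' hq⟩

theorem frame (h : Runs p s K Q) : Runs p s K fun s' => Q s' ∧ Frame p s s' := by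
  obtain ⟨s', k, he, hk, hq⟩ := h
  exact ⟨s', k, he, hk, hq, he.frame⟩

theorem seq (h : Runs p s K fun s' => Runs q s' L Q) : Runs (.seq p q) s (K + L) Q := by
  obtain ⟨s', k, he, hk, s'', l, he', hl, hq⟩ := h
  exact ⟨s'', k + l, .seq he he', by omega, hq⟩

theorem ite (h : b.Holds s → Runs p s K Q) (h' : ¬ b.Holds s → Runs q s K Q) :
    Runs (.ite b p q) s (b.cost + K + 1) Q := by
  by_cases hb : b.Holds s
  · obtain ⟨s', k, he, hk, hq⟩ := h hb
    exact ⟨s', _, .ite_true _ hb he, by omega, hq⟩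
  · obtain ⟨s', k, he, hk, hq⟩ := h' hb
    exact ⟨s', _, .ite_false _ hb he, by omega, hq⟩

/-- A loop whose body decreases the natural number `m` and preserves the invariant `I`. -/
theorem while_of_measure (I : State → Prop) (m : State → ℕ) (hI : I s)
    (hbody : ∀ s, I s → b.Holds s → Runs p s K fun s' => I s' ∧ m s' < m s) :
    Runs (.while b p) s (m s * (b.cost + K + 1) + (b.cost + 1))
      fun s' => I s' ∧ ¬ b.Holds s' := by
  induction hm : m s using Nat.strong_induction_on generalizing s with
  | _ M ih =>
    subst hm
    by_cases hb : b.Holds s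
    · obtain ⟨s', k, he, hk, hI', hlt⟩ := hbody s hI hb
      obtain ⟨s'', l, he', hl, hq⟩ := ih (m s') hlt hI' rfl
      refine ⟨s'', _, .while_true hb he he', ?_, hq⟩
      have : (m s' + 1) * (b.cost + K + 1) ≤ m s * (b.cost + K + 1) :=
        Nat.mul_le_mul_right _ hlt
      rw [Nat.add_mul] at this
      omega
    · exact ⟨s, _, .while_false _ hb, by omega, hI, hb⟩

end Runs

/-- The integer variable stored in the first cell of the array `a`. -/
def IntExpr.var (a : ℕ) : IntExpr := .cell a (.const 0)

/-- The real variable stored in the first cell of the array `a`. -/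
def RealExpr.var (a : ℕ) : RealExpr := .cell a (.const 0) (.const 0)

/-- The entry of the one-dimensional real array `a` with index `i`. -/
def RealExpr.entry (a : ℕ) (i : IntExpr) : RealExpr := .cell a i (.const 0)

namespace Prog

/-- The statement without effect on the arrays that matter: it clears a scratch cell. -/
def skip : Prog := .setInt 14 (.const 0) (.const 0)

/-- Execute `p` with the variable `v` running from zero to the variable `b`, exclusively. -/
def forLoop (v b : ℕ) (p : Prog) : Prog :=
  .seq (.setInt v (.const 0) (.const 0))
    (.while (.neg (.intLE (.var b) (.var v)))
      (.seq p (.setInt v (.const 0) (.add (.var v) (.const 1)))))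

/-- The weakest precondition of a program without loops. -/
def wp : Prog → (State → Prop) → State → Prop
  | setInt a i e, Q, s => Q (s.writeInt a (i.eval s) (e.eval s))
  | setReal a i j e, Q, s => Q (s.writeReal a (i.eval s) (j.eval s) (e.eval s))
  | seq p q, Q, s => p.wp (q.wp Q) s
  | ite b p q, Q, s => (b.Holds s → p.wp Q s) ∧ (¬ b.Holds s → q.wp Q s)
  | .while _ _, _, _ => False

/-- A bound on the running time of a program without loops. -/
def straightCost : Prog → ℕ
  | setInt _ i e => i.cost + e.cost + 1
  | setReal _ i j e => i.cost + j.cost + e.cost + 1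
  | seq p q => p.straightCost + q.straightCost
  | ite b p q => b.cost + (p.straightCost + q.straightCost) + 1
  | .while _ _ => 0

end Prog

/-- Loop-free code reduces to one goal about the memory and one numerical inequality, usually
settled by `decide`. The cost 0 that `straightCost` assigns to a while-loop is harmless, since `wp`
is `False` there. -/
theorem Runs.of_wp {p : Prog} {s : State} {K : ℕ} {Q : State → Prop} (hK : p.straightCost ≤ K)
    (h : p.wp Q s) : Runs p s K Q := by
  refine Runs.mono ?_ hK fun _ => id
  clear hK
  induction p generalizing s Q with
  | setInt a i e => exact ⟨_, _, .setInt a i e s, le_rfl, h⟩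
  | setReal a i j e => exact ⟨_, _, .setReal a i j e s, le_rfl, h⟩
  | seq p q ihp ihq => exact Runs.seq ((ihp h).mono le_rfl fun _ hs => ihq hs)
  | ite b p q ihp ihq =>
    exact Runs.ite (fun hb => (ihp (h.1 hb)).mono (by omega) fun _ => id)
      (fun hb => (ihq (h.2 hb)).mono (by omega) fun _ => id)
  | _ => exact h.elim

/-- Each round costs 13 beyond the body: 6 for the test, 6 for the increment, 1 for the loop.
Initialisation (3) and the last, failing test (7) make up the 10. With the usual body bound 80 a
round costs 93. -/
theorem Runs.forLoop {v b : ℕ} {p : Prog} {s : State} {N K : ℕ} (I : ℕ → State → Prop)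
    (hN : s.int b 0 = N) (hvb : b ≠ v) (hv : p.writesInt v = false) (hb : p.writesInt b = false)
    (h0 : I 0 (s.writeInt v 0 0))
    (hstep : ∀ k < N, ∀ s', Frame (Prog.forLoop v b p) s s' → s'.int v 0 = k → I k s' →
      Runs p s' K fun s'' => I (k + 1) (s''.writeInt v 0 (k + 1))) :
    Runs (Prog.forLoop v b p) s (N * (K + 13) + 10)
      fun s' => I N s' ∧ Frame (Prog.forLoop v b p) s s' := by
  have hbF : (Prog.forLoop v b p).writesInt b = false := by
    simp [Prog.forLoop, Prog.writesInt, hb, hvb.symm]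
  refine Runs.mono (Runs.seq (K := 3) (L := N * (K + 13) + 7) (Q := fun s' =>
    I N s' ∧ Frame (Prog.forLoop v b p) s s') ?_) (by omega) fun _ => id
  refine ⟨_, _, .setInt _ _ _ _, le_rfl, ?_⟩
  have hw := Runs.while_of_measure (b := .neg (.intLE (.var b) (.var v)))
    (p := .seq p (.setInt v (.const 0) (.add (.var v) (.const 1)))) (K := K + 6)
    (s := s.writeInt v ((IntExpr.const 0).eval s) ((IntExpr.const 0).eval s))
    (I := fun s' => s'.int v 0 ≤ N ∧ I (s'.int v 0) s' ∧ Frame (Prog.forLoop v b p) s s')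
    (m := fun s' => N - s'.int v 0) ?_ ?_
  · refine hw.mono ?_ ?_
    · simp [IntExpr.eval, Test.cost, IntExpr.cost, IntExpr.var]
      exact le_of_eq (by ring)
    · rintro s' ⟨⟨h1, h2, h3⟩, h4⟩
      simp only [Test.Holds, IntExpr.eval, IntExpr.var, h3.int b hbF, hN, not_not] at h4
      have : s'.int v 0 = N := le_antisymm h1 h4
      exact ⟨this ▸ h2, h3⟩
  · refine ⟨by simp [IntExpr.eval], by simpa [IntExpr.eval] using h0, ?_⟩
    refine ⟨fun a ha => ?_, fun a ha => rfl⟩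
    have : a ≠ v := by rintro rfl; simp [Prog.forLoop, Prog.writesInt] at ha
    funext i; simp [this]
  · rintro s' ⟨h1, h2, h3⟩ h4
    simp only [Test.Holds, IntExpr.eval, IntExpr.var, h3.int b hbF, hN, not_le] at h4
    refine Runs.mono (Runs.seq (L := 6) ((hstep _ h4 s' h3 rfl h2).frame.mono le_rfl ?_)) le_rfl
      fun _ => id
    rintro s'' ⟨h5, h6⟩
    have hv' : s''.int v 0 = s'.int v 0 := by rw [h6.int v hv]
    refine ⟨_, _, .setInt _ _ _ _, by simp [IntExpr.cost, IntExpr.var], ?_, ?_⟩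
    · simp only [IntExpr.eval, IntExpr.var, hv', State.int_writeInt, and_self, if_true]
      refine ⟨h4, h5, h3.trans ((h6.mono (q := Prog.forLoop v b p) ?_ ?_).trans ⟨?_, ?_⟩)⟩
      · simp +contextual [Prog.forLoop, Prog.writesInt]
      · simp +contextual [Prog.forLoop, Prog.writesReal]
      · intro a ha
        have : a ≠ v := by rintro rfl; simp [Prog.forLoop, Prog.writesInt] at ha
        funext i; simp [this]
      · exact fun _ _ => rfl
    · simp only [IntExpr.eval, IntExpr.var, hv', State.int_writeInt, and_self, if_true]
      omega

end RealRAM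

/-! ### The Hungarian algorithm: one shortest augmenting path search

Rows and columns are natural numbers less than `n`, and the column `n` stands for no column. -/

namespace Hungarian

/-- The potentials `p`, `q` are dual feasible for the weights `w`, and `μ` matches the rows less
than `R` injectively to columns, or to the dummy column `n`, along tight edges. -/
structure Partial (n R : ℕ) (w : ℕ → ℕ → ℝ) (p q : ℕ → ℝ) (μ : ℕ → ℕ) : Prop where
  le : ∀ i < R, μ i ≤ n
  inj : ∀ i < R, ∀ i' < R, μ i = μ i' → i = i'
  feas : ∀ i < n, ∀ j < n, w i j ≤ p i + q j
  tight : ∀ i < R, μ i < n → w i (μ i) = p i + q (μ i)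

/-- The shortest path forest for the reduced costs `c`: columns with positive `rank` are settled,
in the order of their rank, and lie at distance at most `D`. The tentative distance `dist j` is
attained by an edge from the row `way j`. There are `k` settled columns. -/
structure Forest (n R : ℕ) (c : ℕ → ℕ → ℝ) (μ : ℕ → ℕ) (dist : ℕ → ℝ) (way rank : ℕ → ℕ)
    (k : ℕ) (D : ℝ) : Prop where
  dist_dummy : dist n = 0
  rank_dummy : rank n = 1
  rank_le : ∀ j ≤ n, rank j ≤ k
  settled : ∀ j ≤ n, rank j ≠ 0 → dist j ≤ D
  unsettled : ∀ j < n, rank j = 0 → D ≤ dist j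
  way_lt : ∀ j < n, way j < R
  way_settled : ∀ j < n, rank (μ (way j)) ≠ 0
  way_dist : ∀ j < n, dist j = dist (μ (way j)) + c (way j) j
  way_rank : ∀ j < n, rank j ≠ 0 → rank (μ (way j)) < rank j
  card : ((Finset.range (n + 1)).filter fun j => rank j ≠ 0).card = k

/-- All settled columns are matched, to rows whose edges have been relaxed. -/
structure Search (n R : ℕ) (c : ℕ → ℕ → ℝ) (μ : ℕ → ℕ) (dist : ℕ → ℝ) (way rank : ℕ → ℕ)
    (k : ℕ) (D : ℝ) : Prop extends Forest n R c μ dist way rank k D where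
  matched : ∀ j ≤ n, rank j ≠ 0 → ∃ i < R, μ i = j
  relaxed : ∀ i < R, rank (μ i) ≠ 0 → ∀ j < n, dist j ≤ dist (μ i) + c i j

/-- The column `j₁` has just been settled. -/
structure Settling (n R : ℕ) (c : ℕ → ℕ → ℝ) (μ : ℕ → ℕ) (dist : ℕ → ℝ) (way rank : ℕ → ℕ)
    (k : ℕ) (D : ℝ) (j₁ : ℕ) : Prop extends Forest n R c μ dist way rank k D where
  lt : j₁ < n
  rank_ne : rank j₁ ≠ 0
  dist_eq : dist j₁ = D
  matched : ∀ j ≤ n, rank j ≠ 0 → j ≠ j₁ → ∃ i < R, μ i = j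
  relaxed : ∀ i < R, rank (μ i) ≠ 0 → μ i ≠ j₁ → ∀ j < n, dist j ≤ dist (μ i) + c i j

section

variable {n R k : ℕ} {w c : ℕ → ℕ → ℝ} {p q dist dist' : ℕ → ℝ} {μ way way' rank rank' : ℕ → ℕ}
  {D D' : ℝ} {j₁ : ℕ}

/-- This bounds both the number of search rounds and, through the ranks, the length of the
augmenting path. -/
theorem Forest.card_le (h : Forest n R c μ dist way rank k D) : k ≤ n + 1 := by
  rw [← h.card]
  exact (Finset.card_filter_le _ _).trans (by simp)

/-- The new row `R` is parked in the dummy column `n`, which becomes the root at distance 0. Its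
edges count as relaxed because the tentative distances are its reduced costs. -/
theorem Search.init (hc : ∀ j < n, 0 ≤ c R j) (hμ : μ R = n) (hdn : dist n = 0)
    (hd : ∀ j < n, dist j = c R j) (hw : ∀ j < n, way j = R) (hrn : rank n = 1)
    (hr : ∀ j < n, rank j = 0) (hμ' : ∀ i < R, μ i < n) :
    Search n (R + 1) c μ dist way rank 1 0 where
  dist_dummy := hdn
  rank_dummy := hrn
  rank_le j hj := by
    rcases hj.lt_or_eq with h | rfl
    · simp [hr j h]
    · exact hrn.le
  settled j hj h := by
    rcases hj.lt_or_eq with h' | rfl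
    · exact absurd (hr j h') h
    · exact hdn.le
  unsettled j hj _ := by rw [hd j hj]; exact hc j hj
  way_lt j hj := by rw [hw j hj]; omega
  way_settled j hj := by rw [hw j hj, hμ, hrn]; exact one_ne_zero
  way_dist j hj := by rw [hw j hj, hμ, hdn, hd j hj, zero_add]
  way_rank j hj h := absurd (hr j hj) h
  card := by
    rw [Finset.card_eq_one]
    refine ⟨n, Finset.ext fun j => ?_⟩
    simp only [Finset.mem_filter, Finset.mem_range, Finset.mem_singleton]
    constructor
    · rintro ⟨h1, h2⟩
      by_contra h
      exact h2 (hr j (by omega))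
    · rintro rfl
      exact ⟨by omega, by omega⟩
  matched j hj h := by
    rcases hj.lt_or_eq with h' | rfl
    · exact absurd (hr j h') h
    · exact ⟨R, by omega, hμ⟩
  relaxed i hi h j hj := by
    rcases (Nat.lt_succ_iff.mp hi).lt_or_eq with h' | rfl
    · exact absurd (hr _ (hμ' i h')) h
    · rw [hμ, hdn, hd j hj, zero_add]

/-- Settled columns, the dummy included, are matched to distinct rows; `n + 1` of them would need
more than `R ≤ n` rows. -/
theorem Search.exists_unsettled (h : Search n R c μ dist way rank k D) (hR : R ≤ n) :
    ∃ j < n, rank j = 0 := by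
  by_contra! hne
  have hsub : Finset.range (n + 1) ⊆ (Finset.range R).image μ := by
    intro j hj
    have hj' : j ≤ n := by simpa [Nat.lt_succ_iff] using hj
    have : rank j ≠ 0 := by
      rcases hj'.lt_or_eq with h' | rfl
      · exact hne j h'
      · simp [h.rank_dummy]
    obtain ⟨i, hi, rfl⟩ := h.matched j hj' this
    exact Finset.mem_image_of_mem _ (Finset.mem_range.mpr hi)
  have := (Finset.card_le_card hsub).trans Finset.card_image_le
  simp at this
  omega

/-- Dijkstra's greedy step: a closest unsettled column lies beyond all settled ones, so `D` can only
grow. It receives the largest rank so far, so its predecessor has smaller rank. -/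
theorem Search.settle (h : Search n R c μ dist way rank k D) (hj₁ : j₁ < n) (hr : rank j₁ = 0)
    (hD : D' = dist j₁) (hmin : ∀ j < n, rank j = 0 → D' ≤ dist j)
    (hle : ∀ i < R, μ i ≤ n) (h1 : rank' j₁ = k + 1)
    (h2 : ∀ j, j ≠ j₁ → rank' j = rank j) :
    Settling n R c μ dist way rank' (k + 1) D' j₁ := by
  have hne : ∀ j, rank j ≠ 0 → rank' j = rank j := fun j hj =>
    h2 j (by rintro rfl; exact hj hr)
  have hDD : D ≤ D' := hD ▸ h.unsettled j₁ hj₁ hr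
  have hway : ∀ j < n, rank' (μ (way j)) = rank (μ (way j)) := fun j hj =>
    hne _ (h.way_settled j hj)
  refine ⟨⟨h.dist_dummy, ?_, ?_, ?_, ?_, h.way_lt, ?_, h.way_dist, ?_, ?_⟩, hj₁, by omega,
    hD.symm, ?_, ?_⟩
  · rw [h2 n (by omega), h.rank_dummy]
  · intro j hj
    by_cases hjj : j = j₁
    · rw [hjj, h1]
    · rw [h2 j hjj]; exact (h.rank_le j hj).trans (by omega)
  · intro j hj hjr
    by_cases hjj : j = j₁
    · rw [hjj, hD]
    · rw [h2 j hjj] at hjr; exact (h.settled j hj hjr).trans hDD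
  · intro j hj hjr
    have hjj : j ≠ j₁ := by rintro rfl; omega
    rw [h2 j hjj] at hjr
    exact hmin j hj hjr
  · intro j hj; rw [hway j hj]; exact h.way_settled j hj
  · intro j hj hjr
    rw [hway j hj]
    by_cases hjj : j = j₁
    · rw [hjj, h1]
      exact Nat.lt_succ_of_le (h.rank_le _ (hle _ (h.way_lt j₁ hj₁)))
    · rw [h2 j hjj] at hjr ⊢
      exact h.way_rank j hj hjr
  · have : ((Finset.range (n + 1)).filter fun j => rank' j ≠ 0) =
        insert j₁ ((Finset.range (n + 1)).filter fun j => rank j ≠ 0) := by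
      ext j
      simp only [Finset.mem_filter, Finset.mem_range, Finset.mem_insert]
      by_cases hjj : j = j₁
      · subst hjj; simp [h1]; omega
      · simp [h2 j hjj, hjj]
    rw [this, Finset.card_insert_of_notMem (by simp [hr]), h.card]
  · intro j hj hjr hjj
    rw [h2 j hjj] at hjr
    exact h.matched j hj hjr
  · intro i hi hir hij
    rw [h2 _ hij] at hir
    exact h.relaxed i hi hir

/-- Since reduced costs are nonnegative and settled columns lie within `D`, relaxing from distance
`D` alters neither their distances nor their predecessors, and no unsettled column falls below `D`.
-/
theorem Settling.relax (h : Settling n R c μ dist way rank k D j₁) {i₀ : ℕ} (hi₀ : i₀ < R)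
    (hμ : μ i₀ = j₁) (hinj : ∀ i < R, μ i = j₁ → i = i₀) (hle : ∀ i < R, μ i ≤ n)
    (hc : ∀ j < n, 0 ≤ c i₀ j) (hdn : dist' n = dist n)
    (hlt : ∀ j < n, D + c i₀ j < dist j → dist' j = D + c i₀ j ∧ way' j = i₀)
    (hge : ∀ j < n, dist j ≤ D + c i₀ j → dist' j = dist j ∧ way' j = way j) :
    Search n R c μ dist' way' rank k D := by
  have hset : ∀ j ≤ n, rank j ≠ 0 → dist' j = dist j ∧ (j < n → way' j = way j) := by
    intro j hj hjr
    rcases hj.lt_or_eq with hj' | rfl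
    · have := hge j hj' ((h.settled j hj hjr).trans (by linarith [hc j hj']))
      exact ⟨this.1, fun _ => this.2⟩
    · exact ⟨hdn, fun hj => absurd hj (lt_irrefl _)⟩
  have hd1 : dist' j₁ = D := by rw [(hset j₁ h.lt.le h.rank_ne).1, h.dist_eq]
  have hdle : ∀ j < n, dist' j ≤ dist j ∧ dist' j ≤ D + c i₀ j := by
    intro j hj
    rcases lt_or_ge (D + c i₀ j) (dist j) with h' | h'
    · rw [(hlt j hj h').1]; exact ⟨h'.le, le_rfl⟩
    · rw [(hge j hj h').1]; exact ⟨le_rfl, h'⟩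
  have hsw : ∀ j < n, dist' (μ (way j)) = dist (μ (way j)) := fun j hj =>
    (hset _ (hle _ (h.way_lt j hj)) (h.way_settled j hj)).1
  refine ⟨⟨hdn.trans h.dist_dummy, h.rank_dummy, h.rank_le, ?_, ?_, ?_, ?_, ?_, ?_, h.card⟩, ?_, ?_⟩
  · intro j hj hjr; rw [(hset j hj hjr).1]; exact h.settled j hj hjr
  · intro j hj hjr
    rcases lt_or_ge (D + c i₀ j) (dist j) with h' | h'
    · rw [(hlt j hj h').1]; linarith [hc j hj]
    · rw [(hge j hj h').1]; exact h.unsettled j hj hjr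
  · intro j hj
    rcases lt_or_ge (D + c i₀ j) (dist j) with h' | h'
    · rw [(hlt j hj h').2]; exact hi₀
    · rw [(hge j hj h').2]; exact h.way_lt j hj
  · intro j hj
    rcases lt_or_ge (D + c i₀ j) (dist j) with h' | h'
    · rw [(hlt j hj h').2, hμ]; exact h.rank_ne
    · rw [(hge j hj h').2]; exact h.way_settled j hj
  · intro j hj
    rcases lt_or_ge (D + c i₀ j) (dist j) with h' | h'
    · rw [(hlt j hj h').2, (hlt j hj h').1, hμ, hd1]
    · rw [(hge j hj h').2, (hge j hj h').1, hsw j hj]; exact h.way_dist j hj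
  · intro j hj hjr
    rw [(hset j hj.le hjr).2 hj]
    exact h.way_rank j hj hjr
  · intro j hj hjr
    by_cases hjj : j = j₁
    · exact ⟨i₀, hi₀, hμ.trans hjj.symm⟩
    · exact h.matched j hj hjr hjj
  · intro i hi hir j hj
    by_cases hij : μ i = j₁
    · rw [hij, hd1, hinj i hi hij]; exact (hdle j hj).2
    · rw [(hset _ (hle i hi) hir).1]
      exact (hdle j hj).1.trans (h.relaxed i hi hir hij j hj)

/-- The invariant of the augmentation along the path that ends in the column `hole`. -/
structure Augment (n R : ℕ) (w : ℕ → ℕ → ℝ) (p q : ℕ → ℝ) (way rank : ℕ → ℕ) (μ : ℕ → ℕ)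
    (hole : ℕ) : Prop extends Partial n R w p q μ where
  hole_le : hole ≤ n
  rank_ne : rank hole ≠ 0
  free : ∀ i < R, μ i ≠ hole
  rank_dummy : rank n = 1
  way_lt : ∀ j < n, rank j ≠ 0 → way j < R
  way_tight : ∀ j < n, rank j ≠ 0 → w (way j) j = p (way j) + q j
  way_rank : ∀ j < n, rank j ≠ 0 → rank j ≤ rank hole →
    rank (μ (way j)) ≠ 0 ∧ rank (μ (way j)) < rank j

/-- The predecessor row of the hole moves into it, and its old column becomes the hole. Ranks fall
along the way, so the flipping terminates. -/
theorem Augment.step {hole : ℕ} (h : Augment n R w p q way rank μ hole) (hh : hole < n)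
    {μ' : ℕ → ℕ} (h1 : μ' (way hole) = hole) (h2 : ∀ i, i ≠ way hole → μ' i = μ i) :
    Augment n R w p q way rank μ' (μ (way hole)) ∧ rank (μ (way hole)) < rank hole := by
  have hw := h.way_lt hole hh h.rank_ne
  have hr := h.way_rank hole hh h.rank_ne le_rfl
  refine ⟨⟨⟨?_, ?_, h.feas, ?_⟩, h.le _ hw, hr.1, ?_, h.rank_dummy, h.way_lt, h.way_tight, ?_⟩, hr.2⟩
  · intro i hi
    by_cases hi' : i = way hole
    · rw [hi', h1]; exact h.hole_le
    · rw [h2 i hi']; exact h.le i hi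
  · intro i hi i' hi' he
    by_cases hiw : i = way hole <;> by_cases hiw' : i' = way hole
    · rw [hiw, hiw']
    · rw [hiw, h1, h2 i' hiw'] at he; exact absurd he.symm (h.free i' hi')
    · rw [hiw', h1, h2 i hiw] at he; exact absurd he (h.free i hi)
    · rw [h2 i hiw, h2 i' hiw'] at he; exact h.inj i hi i' hi' he
  · intro i hi hlt
    by_cases hi' : i = way hole
    · rw [hi', h1]; exact h.way_tight hole hh h.rank_ne
    · rw [h2 i hi'] at hlt ⊢; exact h.tight i hi hlt
  · intro i hi he
    by_cases hi' : i = way hole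
    · rw [hi', h1] at he; exact h.free _ hw he.symm
    · rw [h2 i hi'] at he; exact hi' (h.inj i hi _ hw he)
  · intro j hj hjr hle
    have hj' := h.way_rank j hj hjr (hle.trans hr.2.le)
    -- Columns ranked no later than the new hole do not have the moved row as predecessor: its old
    -- column, the new hole, would then have smaller rank than `j`. This is why `way_rank` is
    -- restricted by the rank of the hole.
    by_cases hjw : way j = way hole
    · rw [hjw] at hj'; omega
    · rw [h2 _ hjw]; exact hj'

/-- A search that settles a free column yields new potentials for which the edges of the forest
are tight. -/
theorem Settling.augment (hp : Partial n R w p q μ)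
    (h : Settling n R (fun i j => p i + q j - w i j) μ dist way rank k D j₁)
    (hfree : ∀ i < R, μ i ≠ j₁) {p' q' : ℕ → ℝ}
    (hq : ∀ j < n, q' j = q j + (D - min (dist j) D))
    (hp1 : ∀ i < R, p' i = p i - (D - min (dist (μ i)) D)) (hp2 : ∀ i, R ≤ i → p' i = p i) :
    Augment n R w p' q' way rank μ j₁ := by
  have hs : ∀ j ≤ n, rank j ≠ 0 → min (dist j) D = dist j := fun j hj hr =>
    min_eq_left (h.settled j hj hr)
  refine ⟨⟨hp.le, hp.inj, ?_, ?_⟩, h.lt.le, h.rank_ne, hfree, h.rank_dummy,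
    fun j hj _ => h.way_lt j hj, ?_, fun j hj hr _ => ⟨h.way_settled j hj, h.way_rank j hj hr⟩⟩
  · intro i hi j hj
    rw [hq j hj]
    have hf := hp.feas i hi j hj
    have hm := min_le_right (dist j) D
    rcases lt_or_ge i R with hiR | hiR
    · rw [hp1 i hiR]
      -- If the column of row `i` is unsettled, `p i` is unchanged and `q` only grows. Otherwise the
      -- new reduced cost is the old one plus `dist (μ i) - min (dist j) D`, which is nonnegative
      -- since row `i` is relaxed.
      by_cases hr : rank (μ i) = 0
      · have hlt : μ i < n := lt_of_le_of_ne (hp.le i hiR) (by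
          intro he; rw [he, h.rank_dummy] at hr; exact one_ne_zero hr)
        rw [min_eq_right (h.unsettled _ hlt hr)]
        linarith
      · rw [hs _ (hp.le i hiR) hr]
        have := h.relaxed i hiR hr (hfree i hiR) j hj
        linarith [min_le_left (dist j) D]
    · rw [hp2 i hiR]; linarith
  · intro i hi hlt
    -- The shifts at the two ends of a matched edge cancel.
    rw [hq _ hlt, hp1 i hi, hp.tight i hi hlt]
    ring
  · intro j hj hr
    have hw := h.way_lt j hj
    -- On a forest edge both distances are at most `D`, and they differ by the old reduced cost, so
    -- the new one is zero.
    rw [hq j hj, hp1 _ hw, hs j hj.le hr, hs _ (hp.le _ hw) (h.way_settled j hj)]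
    have := h.way_dist j hj
    linarith

end

end Hungarian

/-! ### The program

Integer arrays: `0` size `n`, `1` iteration number, `2` current row, `3` column counter, `4` row
counter, `5` number of active rows, `6` selected column, `7` number of settled columns, `8` column
of each row, `9` predecessor row of each column, `10` rank of each column, `11` row to be relaxed,
`12` search flag, `13` temporary, `14` scratch.

Real arrays: `0` utilities, `1` disagreement utilities, `2` gap, `3` scaling parameter, `4`
iterate, `5` threshold of the extended logarithm, `6` accumulator, `7` row potentials, `8` column
potentials, `9` derivatives of the summands of the objective, `10` tentative distances, `11`
current distance. -/

namespace RealRAM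

open IntExpr (var)

/-- The current edge weight of the row `i` and the column `j`. -/
def State.weight (s : State) (i j : ℕ) : ℝ := s.real 9 i 0 * s.real 0 i j

/-- The reduced cost of the edge between the row `i` and the column `j`. -/
def State.redCost (s : State) (i j : ℕ) : ℝ := s.real 7 i 0 + s.real 8 j 0 - s.weight i j

/-- The reduced cost, as an expression. -/
def RealExpr.redCost (i j : IntExpr) : RealExpr :=
  .sub (.add (.entry 7 i) (.entry 8 j)) (.mul (.entry 9 i) (.cell 0 i j))

@[simp] theorem IntExpr.eval_var (s : State) (a : ℕ) : (var a).eval s = s.int a 0 := rfl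

@[simp] theorem RealExpr.eval_var (s : State) (a : ℕ) :
    (RealExpr.var a).eval s = s.real a 0 0 := rfl

@[simp] theorem RealExpr.eval_entry (s : State) (a : ℕ) (i : IntExpr) :
    (RealExpr.entry a i).eval s = s.real a (i.eval s) 0 := rfl

@[simp] theorem RealExpr.eval_redCost (s : State) (i j : IntExpr) :
    (RealExpr.redCost i j).eval s = s.redCost (i.eval s) (j.eval s) := rfl

namespace Prog

/-- Assignment to an integer variable. -/
def letInt (a : ℕ) (e : IntExpr) : Prog := .setInt a (.const 0) e

/-- Assignment to a real variable. -/
def letReal (a : ℕ) (e : RealExpr) : Prog := .setReal a (.const 0) (.const 0) e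

/-- Select an unsettled column of least distance. -/
def selectColumn : Prog :=
  .seq (letInt 6 (var 0)) <| forLoop 3 0 <|
    .ite (.intLE (.cell 10 (var 3)) (.const 0))
      (.ite (.and (.neg (.intLE (var 0) (var 6))) (.realLE (.var 11) (.entry 10 (var 3)))) skip
        (.seq (letReal 11 (.entry 10 (var 3))) (letInt 6 (var 3)))) skip

/-- Find the active row that is matched to the selected column. -/
def findRow : Prog :=
  .seq (letInt 11 (var 0)) <| forLoop 4 5 <|
    .ite (.and (.intLE (.cell 8 (var 4)) (var 6)) (.intLE (var 6) (.cell 8 (var 4))))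
      (letInt 11 (var 4)) skip

/-- The distance of a column through the row to be relaxed. -/
def newDist : RealExpr := .add (.var 11) (.redCost (var 11) (var 3))

/-- Relax the edges of a row. -/
def relaxRow : Prog :=
  forLoop 3 0 <| .ite (.realLE (.entry 10 (var 3)) newDist) skip
    (.seq (.setReal 10 (var 3) (.const 0) newDist) (.setInt 9 (var 3) (var 11)))

/-- Settle the selected column. -/
def settleColumn : Prog :=
  .seq (letInt 7 (.add (var 7) (.const 1))) (.setInt 10 (var 6) (var 7))

/-- One step of the shortest path search. -/
def searchStep : Prog :=
  .seq selectColumn <| .seq settleColumn <| .seq findRow <|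
    .ite (.intLE (var 0) (var 11)) (letInt 12 (.const 1)) relaxRow

end Prog

/-- The value `n` of the selected column means that no candidate has been seen, so no infinite
initial minimum is needed. -/
theorem runs_selectColumn {s : State} {n : ℕ} (hn : s.int 0 0 = n)
    (hex : ∃ j < n, s.int 10 j = 0) :
    Runs .selectColumn s (n * 93 + 20) fun s' => (s'.int 6 0 < n ∧ s.int 10 (s'.int 6 0) = 0 ∧
      s'.real 11 0 0 = s.real 10 (s'.int 6 0) 0 ∧
      ∀ j < n, s.int 10 j = 0 → s'.real 11 0 0 ≤ s.real 10 j 0) ∧ Frame .selectColumn s s' := by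
  apply Runs.frame
  refine Runs.mono (Runs.seq (K := 4) (L := n * 93 + 10) (Runs.of_wp (by decide) ?_)) (by omega)
    fun _ => id
  simp only [Prog.letInt, Prog.wp, IntExpr.eval, IntExpr.eval_var]
  refine (Runs.forLoop (N := n) (K := 80) (fun m s' =>
    (s'.int 6 0 = n ∧ ∀ j < m, s.int 10 j ≠ 0) ∨
      (s'.int 6 0 < n ∧ s.int 10 (s'.int 6 0) = 0 ∧ s'.real 11 0 0 = s.real 10 (s'.int 6 0) 0 ∧
      ∀ j < m, s.int 10 j = 0 → s'.real 11 0 0 ≤ s.real 10 j 0)) (by simp [hn]) (by decide) rfl rfl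
      ?_ ?_).mono le_rfl ?_
  · left; simp [hn]
  · intro k hk s' hF h3 hI
    apply Runs.of_wp (by decide)
    have h10 := hF.int 10 rfl
    have h10' := hF.real 10 rfl
    have h0 := hF.int 0 rfl
    simp only [funext_iff, State.int_writeInt, State.real_writeInt] at h10 h10' h0
    simp at h10 h0
    simp [Prog.wp, Prog.letReal, Prog.skip, IntExpr.eval, Test.Holds,
      h10, h10', h0, h3, hn]
    grind
  · rintro s' ⟨⟨h1, h2⟩ | h, hF⟩
    · obtain ⟨j, hj, hj'⟩ := hex
      exact absurd hj' (h2 j hj)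
    · exact h

theorem runs_settleColumn {s : State} :
    Runs .settleColumn s 20 fun s' => (s'.int 7 0 = s.int 7 0 + 1 ∧
      s'.int 10 (s.int 6 0) = s.int 7 0 + 1 ∧ ∀ j, j ≠ s.int 6 0 → s'.int 10 j = s.int 10 j) ∧
      Frame .settleColumn s s' := by
  apply Runs.frame
  apply Runs.of_wp (by decide)
  simp +contextual [Prog.settleColumn, Prog.wp, Prog.letInt, IntExpr.eval]

/-- A linear scan replaces an inverse array for the matching and stays within O(n) per round. The
result `n` signals that the column is free. -/
theorem runs_findRow {s : State} {n R : ℕ} (hn : s.int 0 0 = n) (hR : s.int 5 0 = R) (hRn : R ≤ n) :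
    Runs .findRow s (n * 93 + 20) fun s' => ((s'.int 11 0 = n ∧ ∀ i < R, s.int 8 i ≠ s.int 6 0) ∨
      (s'.int 11 0 < R ∧ s.int 8 (s'.int 11 0) = s.int 6 0)) ∧ Frame .findRow s s' := by
  apply Runs.frame
  refine Runs.mono (Runs.seq (K := 4) (L := R * 93 + 10) (Runs.of_wp (by decide) ?_)) (by omega)
    fun _ => id
  simp only [Prog.letInt, Prog.wp, IntExpr.eval, IntExpr.eval_var]
  refine (Runs.forLoop (N := R) (K := 80) (fun m s' =>
    (s'.int 11 0 = n ∧ ∀ i < m, s.int 8 i ≠ s.int 6 0) ∨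
      (s'.int 11 0 < R ∧ s.int 8 (s'.int 11 0) = s.int 6 0)) (by simp [hR]) (by decide) rfl rfl
      ?_ ?_).mono le_rfl (fun s' h => h.1)
  · left; simp [hn]
  · intro k hk s' hF h4 hI
    apply Runs.of_wp (by decide)
    have h8 := hF.int 8 rfl
    have h6 := hF.int 6 rfl
    simp only [funext_iff, State.int_writeInt] at h8 h6
    simp at h8 h6
    simp [Prog.wp, Prog.skip, IntExpr.eval, Test.Holds, h8, h6, h4]
    grind

theorem runs_relaxRow {s : State} {n : ℕ} (hn : s.int 0 0 = n) :
    Runs .relaxRow s (n * 93 + 10) fun s' => ((∀ j < n,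
      (s.real 11 0 0 + s.redCost (s.int 11 0) j < s.real 10 j 0 →
        s'.real 10 j 0 = s.real 11 0 0 + s.redCost (s.int 11 0) j ∧ s'.int 9 j = s.int 11 0) ∧
      (s.real 10 j 0 ≤ s.real 11 0 0 + s.redCost (s.int 11 0) j →
        s'.real 10 j 0 = s.real 10 j 0 ∧ s'.int 9 j = s.int 9 j)) ∧
      s'.real 10 n 0 = s.real 10 n 0) ∧ Frame .relaxRow s s' := by
  apply Runs.frame
  refine (Runs.forLoop (N := n) (K := 80) (fun m s' => (∀ j < m,
      (s.real 11 0 0 + s.redCost (s.int 11 0) j < s.real 10 j 0 →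
        s'.real 10 j 0 = s.real 11 0 0 + s.redCost (s.int 11 0) j ∧ s'.int 9 j = s.int 11 0) ∧
      (s.real 10 j 0 ≤ s.real 11 0 0 + s.redCost (s.int 11 0) j →
        s'.real 10 j 0 = s.real 10 j 0 ∧ s'.int 9 j = s.int 9 j)) ∧
      ∀ j, m ≤ j → s'.real 10 j 0 = s.real 10 j 0 ∧ s'.int 9 j = s.int 9 j) hn (by decide) rfl rfl
      ?_ ?_).mono le_rfl (fun s' h => ⟨h.1.1, (h.1.2 n le_rfl).1⟩)
  · simp
  · intro k hk s' hF h3 hI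
    apply Runs.of_wp (by decide)
    have h11 := hF.int 11 rfl
    have h11' := hF.real 11 rfl
    have hc : s'.redCost = s.redCost := by
      funext i j
      simp only [State.redCost, State.weight, hF.real 7 rfl, hF.real 8 rfl, hF.real 9 rfl,
        hF.real 0 rfl]
    simp [Prog.wp, Prog.newDist, Prog.skip, IntExpr.eval, RealExpr.eval, Test.Holds, h11, h11',
      h3, hc]
    obtain ⟨h1, h2⟩ := hI
    rw [(h2 k le_rfl).1]
    refine ⟨fun hle => ⟨fun j hj => ?_, fun j hj => h2 j hj.le⟩,
      fun hlt => ⟨fun j hj => ?_, fun j hj => ?_⟩⟩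
    · rcases hj.lt_or_eq with hj | rfl
      · exact h1 j hj
      · exact ⟨fun h => absurd hle h.not_ge, fun _ => h2 j le_rfl⟩
    · rcases hj.lt_or_eq with hj | rfl
      · simpa [hj.ne] using h1 j hj
      · simp [hlt.not_ge]
    · simpa [hj.ne'] using h2 j hj.le

/-- The data of the shortest path search in the memory `s`. -/
def SearchAt (n R : ℕ) (s : State) : Prop :=
  Hungarian.Search n R s.redCost (s.int 8) (fun j => s.real 10 j 0) (s.int 9) (s.int 10)
    (s.int 7 0) (s.real 11 0 0)

/-- The data of a finished shortest path search in the memory `s`. -/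
def FoundAt (n R : ℕ) (s : State) : Prop :=
  Hungarian.Settling n R s.redCost (s.int 8) (fun j => s.real 10 j 0) (s.int 9) (s.int 10)
    (s.int 7 0) (s.real 11 0 0) (s.int 6 0) ∧ ∀ i < R, s.int 8 i ≠ s.int 6 0

theorem runs_searchStep {s : State} {n R : ℕ} (hn : s.int 0 0 = n) (hR : s.int 5 0 = R)
    (hRn : R ≤ n) (hle : ∀ i < R, s.int 8 i ≤ n)
    (hinj : ∀ i < R, ∀ i' < R, s.int 8 i = s.int 8 i' → i = i')
    (hc : ∀ i < R, ∀ j < n, 0 ≤ s.redCost i j) (h12 : s.int 12 0 = 0) (h : SearchAt n R s) :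
    Runs .searchStep s (n * 279 + 100) fun s' => (s'.int 7 0 = s.int 7 0 + 1 ∧
      ((s'.int 12 0 = 0 ∧ SearchAt n R s') ∨ (s'.int 12 0 = 1 ∧ FoundAt n R s'))) ∧
      Frame .searchStep s s' := by
  apply Runs.frame
  refine Runs.mono (Runs.seq (K := n * 93 + 20) (L := n * 186 + 80) ?_) (by omega) fun _ => id
  refine (runs_selectColumn hn (h.exists_unsettled hRn)).mono le_rfl ?_
  rintro s₁ ⟨⟨h6, hr, hD, hmin⟩, hF₁⟩
  refine Runs.mono (Runs.seq (K := 20) (L := n * 186 + 50) ?_) (by omega) fun _ => id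
  refine runs_settleColumn.mono le_rfl ?_
  rintro s₂ ⟨⟨h7, h10, h10'⟩, hF₂⟩
  have i0 : s₂.int 0 = s.int 0 := by rw [hF₂.int 0 rfl, hF₁.int 0 rfl]
  have i5 : s₂.int 5 = s.int 5 := by rw [hF₂.int 5 rfl, hF₁.int 5 rfl]
  have i8 : s₂.int 8 = s.int 8 := by rw [hF₂.int 8 rfl, hF₁.int 8 rfl]
  have i9 : s₂.int 9 = s.int 9 := by rw [hF₂.int 9 rfl, hF₁.int 9 rfl]
  have i12 : s₂.int 12 = s.int 12 := by rw [hF₂.int 12 rfl, hF₁.int 12 rfl]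
  have i6 : s₂.int 6 = s₁.int 6 := hF₂.int 6 rfl
  have i7 : s₂.int 7 0 = s.int 7 0 + 1 := by rw [h7, hF₁.int 7 rfl]
  rw [hF₁.int 7 rfl] at h10
  rw [hF₁.int 10 rfl] at h10'
  have r2 : s₂.real = s₁.real := funext fun a => hF₂.real a rfl
  have r10 : s₂.real 10 = s.real 10 := by rw [r2, hF₁.real 10 rfl]
  have c2 : s₂.redCost = s.redCost := by
    funext i j
    simp only [State.redCost, State.weight, r2, hF₁.real 7 rfl, hF₁.real 8 rfl, hF₁.real 9 rfl,
      hF₁.real 0 rfl]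
  have hS : Hungarian.Settling n R s.redCost (s.int 8) (fun j => s.real 10 j 0) (s.int 9)
      (s₂.int 10) (s.int 7 0 + 1) (s₁.real 11 0 0) (s₁.int 6 0) :=
    Hungarian.Search.settle h h6 hr hD hmin hle h10 h10'
  refine Runs.mono (Runs.seq (K := n * 93 + 20) (L := n * 93 + 20) ?_) (by omega) fun _ => id
  refine (runs_findRow (n := n) (R := R) (by rw [i0, hn]) (by rw [i5, hR]) hRn).mono le_rfl ?_
  rintro s₃ ⟨hi₀, hF₃⟩
  rw [i8, i6] at hi₀
  have c3 : s₃.redCost = s.redCost := by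
    rw [← c2]
    funext i j
    simp only [State.redCost, State.weight, hF₃.real 7 rfl, hF₃.real 8 rfl, hF₃.real 9 rfl,
      hF₃.real 0 rfl]
  have n3 : s₃.int 0 0 = n := by rw [hF₃.int 0 rfl, i0, hn]
  refine Runs.mono (Runs.ite (K := n * 93 + 10) (fun hb => ?_) (fun hb => ?_))
    (by simp [Test.cost, IntExpr.cost, var]; omega) fun _ => id
  · simp only [Test.Holds, IntExpr.eval_var, n3] at hb
    have hfree : ∀ i < R, s.int 8 i ≠ s₁.int 6 0 := by
      rcases hi₀ with h | h
      · exact h.2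
      · omega
    refine (Runs.of_wp (Q := fun s' => s'.int 12 0 = 1) (K := 10) (by decide) ?_).frame.mono
      (by omega) ?_
    · simp [Prog.letInt, Prog.wp, IntExpr.eval]
    rintro s₄ ⟨h12', hF₄⟩
    have j7 : s₄.int 7 = s₂.int 7 := by rw [hF₄.int 7 rfl, hF₃.int 7 rfl]
    have j6 : s₄.int 6 = s₂.int 6 := by rw [hF₄.int 6 rfl, hF₃.int 6 rfl]
    have j8 : s₄.int 8 = s₂.int 8 := by rw [hF₄.int 8 rfl, hF₃.int 8 rfl]
    have j9 : s₄.int 9 = s₂.int 9 := by rw [hF₄.int 9 rfl, hF₃.int 9 rfl]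
    have j10 : s₄.int 10 = s₂.int 10 := by rw [hF₄.int 10 rfl, hF₃.int 10 rfl]
    have r4 : s₄.real = s₃.real := funext fun a => hF₄.real a rfl
    refine ⟨by rw [j7, i7], Or.inr ⟨h12', ?_, ?_⟩⟩
    · rw [j8, j9, j10, j7, j6, i8, i9, i7, i6, r4, hF₃.real 10 rfl, hF₃.real 11 rfl, r10, r2,
        show s₄.redCost = s.redCost by rw [← c3]; unfold State.redCost State.weight; rw [r4]]
      exact hS
    · rw [j6, j8, i8, i6]
      exact hfree
  · simp only [Test.Holds, IntExpr.eval_var, n3] at hb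
    have hrow : s₃.int 11 0 < R ∧ s.int 8 (s₃.int 11 0) = s₁.int 6 0 := by
      rcases hi₀ with h | h
      · omega
      · exact h
    refine (runs_relaxRow n3).mono le_rfl ?_
    rintro s₄ ⟨⟨hrel, hdn⟩, hF₄⟩
    have j9 : s₃.int 9 = s.int 9 := by rw [hF₃.int 9 rfl, i9]
    have r3 : s₃.real 10 = s.real 10 := by rw [hF₃.real 10 rfl, r10]
    have r3' : s₃.real 11 = s₁.real 11 := by rw [hF₃.real 11 rfl, r2]
    rw [c3, j9, r3, r3'] at hrel
    rw [r3] at hdn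
    have c4 : s₄.redCost = s.redCost := by
      rw [← c3]
      funext i j
      simp only [State.redCost, State.weight, hF₄.real 7 rfl, hF₄.real 8 rfl, hF₄.real 9 rfl,
        hF₄.real 0 rfl]
    refine ⟨by rw [hF₄.int 7 rfl, hF₃.int 7 rfl, i7], Or.inl ⟨?_, ?_⟩⟩
    · rw [hF₄.int 12 rfl, hF₃.int 12 rfl, i12, h12]
    · unfold SearchAt
      rw [c4, hF₄.int 8 rfl, hF₃.int 8 rfl, i8, hF₄.int 10 rfl, hF₃.int 10 rfl, hF₄.int 7 rfl,
        hF₃.int 7 rfl, i7, hF₄.real 11 rfl, r3']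
      exact hS.relax hrow.1 hrow.2 (fun i hi he => hinj i hi _ hrow.1 (he.trans hrow.2.symm)) hle
        (hc _ hrow.1) hdn (fun j hj => (hrel j hj).1) (fun j hj => (hrel j hj).2)

/-- The shortest path search, until a column is found that is not matched. -/
def Prog.search : Prog := .while (.intLE (var 12) (.const 0)) .searchStep

/-- Every round settles one more column and at most `n + 1` exist, so `n + 2` minus their number is
a decreasing measure. -/
theorem runs_search {s : State} {n R : ℕ} (hn : s.int 0 0 = n) (hR : s.int 5 0 = R)
    (hRn : R ≤ n) (hle : ∀ i < R, s.int 8 i ≤ n)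
    (hinj : ∀ i < R, ∀ i' < R, s.int 8 i = s.int 8 i' → i = i')
    (hc : ∀ i < R, ∀ j < n, 0 ≤ s.redCost i j) (h12 : s.int 12 0 = 0) (h : SearchAt n R s) :
    Runs .search s ((n + 2) * (n * 279 + 110) + 10) fun s' =>
      FoundAt n R s' ∧ Frame .search s s' := by
  refine (Runs.while_of_measure (K := n * 279 + 100) (fun s' => ((s'.int 12 0 = 0 ∧
    SearchAt n R s') ∨ (s'.int 12 0 = 1 ∧ FoundAt n R s')) ∧ Frame .search s s')
    (fun s' => n + 2 - s'.int 7 0) ?_ ?_).mono ?_ ?_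
  · exact ⟨Or.inl ⟨h12, h⟩, Frame.refl _ _⟩
  · rintro s₁ ⟨h₁, hF⟩ hb
    simp only [Test.Holds, IntExpr.eval_var, IntExpr.eval] at hb
    obtain ⟨h12', hS⟩ : s₁.int 12 0 = 0 ∧ SearchAt n R s₁ := by
      rcases h₁ with h | h
      · exact h
      · omega
    have c1 : s₁.redCost = s.redCost := by
      funext i j
      simp only [State.redCost, State.weight, hF.real 7 rfl, hF.real 8 rfl, hF.real 9 rfl,
        hF.real 0 rfl]
    have e8 := hF.int 8 rfl
    refine (runs_searchStep (by rw [hF.int 0 rfl, hn]) (by rw [hF.int 5 rfl, hR]) hRn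
      (by rwa [e8]) (by rwa [e8]) (by rwa [c1]) h12' hS).mono le_rfl ?_
    rintro s₂ ⟨⟨h7, h₂⟩, hF₂⟩
    refine ⟨⟨h₂, hF.trans (hF₂.mono (fun _ => id) fun _ => id)⟩, ?_⟩
    have : s₂.int 7 0 ≤ n + 1 := by
      rcases h₂ with h | h
      · exact h.2.card_le
      · exact h.2.1.card_le
    omega
  · simp only [Test.cost, IntExpr.cost, var]
    exact Nat.add_le_add (Nat.mul_le_mul (by omega) (by omega)) (by omega)
  · rintro s' ⟨⟨h | h, hF⟩, hb⟩
    · simp [Test.Holds, IntExpr.eval, h.1] at hb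
    · exact ⟨h.2, hF⟩

end RealRAM

/-! ### Phases of the Hungarian algorithm: initialisation, dual update and augmentation -/

namespace RealRAM

open IntExpr (var)

namespace Prog

/-- Start the search from the current row. -/
def initSearch : Prog :=
  .seq (.seq (letInt 5 (.add (var 2) (.const 1))) <| .seq (.setInt 8 (var 2) (var 0)) <|
    .seq (.setReal 10 (var 0) (.const 0) (.ofInt (.const 0))) <|
    .seq (.setInt 10 (var 0) (.const 1)) <| .seq (letInt 7 (.const 1)) <|
    .seq (letInt 12 (.const 0)) (letReal 11 (.ofInt (.const 0)))) <|
  forLoop 3 0 <|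
    .seq (.setReal 10 (var 3) (.const 0) (.redCost (var 2) (var 3))) <|
    .seq (.setInt 9 (var 3) (var 2)) (.setInt 10 (var 3) (.const 0))

/-- Update the column potentials. -/
def updateColumns : Prog :=
  forLoop 3 0 <| .ite (.realLE (.var 11) (.entry 10 (var 3))) skip
    (.setReal 8 (var 3) (.const 0)
      (.add (.entry 8 (var 3)) (.sub (.var 11) (.entry 10 (var 3)))))

/-- Update the row potentials. -/
def updateRows : Prog :=
  forLoop 4 5 <| .ite (.realLE (.var 11) (.entry 10 (.cell 8 (var 4)))) skip
    (.setReal 7 (var 4) (.const 0)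
      (.sub (.entry 7 (var 4)) (.sub (.var 11) (.entry 10 (.cell 8 (var 4))))))

/-- Augment the matching along the path that ends in the selected column. -/
def augment : Prog :=
  .while (.neg (.intLE (var 0) (var 6))) <|
    .seq (letInt 4 (.cell 9 (var 6))) <| .seq (letInt 13 (.cell 8 (var 4))) <|
    .seq (.setInt 8 (var 4) (var 6)) (letInt 6 (var 13))

/-- Match one more row. -/
def phase : Prog :=
  .seq initSearch <| .seq search <| .seq updateColumns <| .seq updateRows augment

/-- The Hungarian algorithm. -/
def hungarian : Prog := forLoop 2 0 phase

end Prog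

/-- The matching and the potentials in the memory `s`. -/
def PartialAt (n R : ℕ) (s : State) : Prop :=
  Hungarian.Partial n R s.weight (fun i => s.real 7 i 0) (fun j => s.real 8 j 0) (s.int 8)

/-- All rows less than `R` are matched. -/
def MatchedAt (n R : ℕ) (s : State) : Prop := PartialAt n R s ∧ ∀ i < R, s.int 8 i < n

theorem weight_eq_of_real {s s' : State} (h9 : s'.real 9 = s.real 9) (h0 : s'.real 0 = s.real 0) :
    s'.weight = s.weight := by
  funext i j
  simp only [State.weight, h9, h0]

theorem redCost_eq_of_real {s s' : State} (h7 : s'.real 7 = s.real 7) (h8 : s'.real 8 = s.real 8)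
    (h9 : s'.real 9 = s.real 9) (h0 : s'.real 0 = s.real 0) : s'.redCost = s.redCost := by
  funext i j
  simp only [State.redCost, weight_eq_of_real h9 h0, h7, h8]

theorem runs_initSearch {s : State} {n r : ℕ} (hn : s.int 0 0 = n) (hr : s.int 2 0 = r)
    (hrn : r < n) (h : MatchedAt n r s) :
    Runs .initSearch s (n * 93 + 60) fun s' => (s'.int 5 0 = r + 1 ∧ s'.int 12 0 = 0 ∧
      PartialAt n (r + 1) s' ∧ SearchAt n (r + 1) s') ∧ Frame .initSearch s s' := by
  apply Runs.frame
  refine Runs.mono (Runs.seq (K := 50) (L := n * 93 + 10) ?_) (by omega) fun _ => id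
  refine (Runs.of_wp (Q := fun s' => s'.int 5 0 = r + 1 ∧ s'.int 12 0 = 0 ∧ s'.int 8 r = n ∧
    (∀ i, i ≠ r → s'.int 8 i = s.int 8 i) ∧ s'.real 10 n 0 = 0 ∧ s'.int 10 n = 1 ∧
    s'.int 7 0 = 1 ∧ s'.real 11 0 0 = 0) (by decide) ?_).frame.mono le_rfl ?_
  · simp +contextual [Prog.letInt, Prog.letReal, Prog.wp, IntExpr.eval, RealExpr.eval, hn, hr]
  rintro s₁ ⟨⟨h5, h12, h8, h8', hd, h10, h7, h11⟩, hF₁⟩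
  have c1 : s₁.redCost = s.redCost :=
    redCost_eq_of_real (hF₁.real 7 rfl) (hF₁.real 8 rfl) (hF₁.real 9 rfl) (hF₁.real 0 rfl)
  have n1 : s₁.int 0 0 = n := by rw [hF₁.int 0 rfl, hn]
  have r1 : s₁.int 2 0 = r := by rw [hF₁.int 2 rfl, hr]
  refine (Runs.forLoop (N := n) (K := 80) (fun m s' => (∀ j < m,
      s'.real 10 j 0 = s.redCost r j ∧ s'.int 9 j = r ∧ s'.int 10 j = 0) ∧
      s'.real 10 n 0 = 0 ∧ s'.int 10 n = 1) n1 (by decide) rfl rfl ?_ ?_).mono le_rfl ?_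
  · simp [hd, h10]
  · intro k hk s' hF h3 hI
    apply Runs.of_wp (by decide)
    have c' : s'.redCost = s.redCost := by
      rw [← c1]
      exact redCost_eq_of_real (hF.real 7 rfl) (hF.real 8 rfl) (hF.real 9 rfl) (hF.real 0 rfl)
    have h2 : s'.int 2 0 = r := by rw [hF.int 2 rfl, r1]
    simp [Prog.wp, IntExpr.eval, h3, h2, c']
    grind
  · rintro s₂ ⟨⟨hj, hd', h10'⟩, hF₂⟩
    have e8 : s₂.int 8 = s₁.int 8 := hF₂.int 8 rfl
    have c2 : s₂.redCost = s.redCost := by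
      rw [← c1]
      exact redCost_eq_of_real (hF₂.real 7 rfl) (hF₂.real 8 rfl) (hF₂.real 9 rfl) (hF₂.real 0 rfl)
    have w2 : s₂.weight = s.weight := weight_eq_of_real
      ((hF₂.real 9 rfl).trans (hF₁.real 9 rfl)) ((hF₂.real 0 rfl).trans (hF₁.real 0 rfl))
    obtain ⟨hp, hlt⟩ := h
    refine ⟨by rw [hF₂.int 5 rfl, h5], by rw [hF₂.int 12 rfl, h12], ?_, ?_⟩
    · unfold PartialAt
      rw [w2, e8, hF₂.real 7 rfl, hF₂.real 8 rfl, hF₁.real 7 rfl, hF₁.real 8 rfl]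
      have hcase : ∀ i < r + 1, (i = r ∧ s₁.int 8 i = n) ∨ (i < r ∧ s₁.int 8 i = s.int 8 i) := by
        intro i hi
        by_cases hir : i = r
        · exact Or.inl ⟨hir, hir ▸ h8⟩
        · exact Or.inr ⟨by omega, h8' i hir⟩
      refine ⟨?_, ?_, hp.feas, ?_⟩
      · intro i hi
        rcases hcase i hi with ⟨_, h⟩ | ⟨h', h⟩
        · exact h.le
        · rw [h]; exact hp.le i h'
      · intro i hi i' hi' he
        rcases hcase i hi with ⟨a, h⟩ | ⟨a, h⟩ <;> rcases hcase i' hi' with ⟨b, h'⟩ | ⟨b, h'⟩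
        · omega
        · have := hlt i' b; omega
        · have := hlt i a; omega
        · exact hp.inj i a i' b (by omega)
      · intro i hi hin
        rcases hcase i hi with ⟨_, h⟩ | ⟨h', h⟩
        · omega
        · rw [h] at hin ⊢; exact hp.tight i h' hin
    · unfold SearchAt
      rw [c2, e8, hF₂.int 7 rfl, h7, hF₂.real 11 rfl, h11]
      refine Hungarian.Search.init ?_ h8 hd' (fun j h => (hj j h).1) (fun j h => (hj j h).2.1) h10'
        (fun j h => (hj j h).2.2) (fun i hi => by rw [h8' i hi.ne]; exact hlt i hi)
      intro j hj
      have := hp.feas r hrn j hj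
      simp only [State.redCost]
      linarith

theorem runs_updateColumns {s : State} {n : ℕ} (hn : s.int 0 0 = n) :
    Runs .updateColumns s (n * 93 + 10) fun s' => (∀ j < n,
      s'.real 8 j 0 = s.real 8 j 0 + (s.real 11 0 0 - min (s.real 10 j 0) (s.real 11 0 0))) ∧
      Frame .updateColumns s s' := by
  refine (Runs.forLoop (N := n) (K := 80) (fun m s' => (∀ j < m,
      s'.real 8 j 0 = s.real 8 j 0 + (s.real 11 0 0 - min (s.real 10 j 0) (s.real 11 0 0))) ∧
      ∀ j, m ≤ j → s'.real 8 j 0 = s.real 8 j 0) hn (by decide) rfl rfl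
      ?_ ?_).mono le_rfl (fun s' h => ⟨h.1.1, h.2⟩)
  · simp
  · intro k hk s' hF h3 hI
    apply Runs.of_wp (by decide)
    simp [Prog.wp, Prog.skip, IntExpr.eval, RealExpr.eval, Test.Holds, h3, hF.real 10 rfl,
      hF.real 11 rfl]
    grind

theorem runs_updateRows {s : State} {R : ℕ} (hR : s.int 5 0 = R) :
    Runs .updateRows s (R * 93 + 10) fun s' => ((∀ i < R, s'.real 7 i 0 =
      s.real 7 i 0 - (s.real 11 0 0 - min (s.real 10 (s.int 8 i) 0) (s.real 11 0 0))) ∧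
      ∀ i, R ≤ i → s'.real 7 i 0 = s.real 7 i 0) ∧ Frame .updateRows s s' := by
  refine (Runs.forLoop (N := R) (K := 80) (fun m s' => (∀ i < m, s'.real 7 i 0 =
      s.real 7 i 0 - (s.real 11 0 0 - min (s.real 10 (s.int 8 i) 0) (s.real 11 0 0))) ∧
      ∀ i, m ≤ i → s'.real 7 i 0 = s.real 7 i 0) hR (by decide) rfl rfl
      ?_ ?_).mono le_rfl (fun s' h => h)
  · simp
  · intro k hk s' hF h3 hI
    apply Runs.of_wp (by decide)
    simp [Prog.wp, Prog.skip, IntExpr.eval, RealExpr.eval, Test.Holds, h3, hF.real 10 rfl,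
      hF.real 11 rfl, hF.int 8 rfl]
    grind

/-- The measure is the rank of the hole, at most `n + 1`. At exit the hole is the dummy column,
which is free, so every active row has a genuine column. -/
theorem runs_augment {s : State} {n R : ℕ} (hn : s.int 0 0 = n) {w : ℕ → ℕ → ℝ} {p q : ℕ → ℝ}
    (h : Hungarian.Augment n R w p q (s.int 9) (s.int 10) (s.int 8) (s.int 6 0))
    (hr : s.int 10 (s.int 6 0) ≤ n + 1) :
    Runs .augment s ((n + 1) * 50 + 10) fun s' => (Hungarian.Partial n R w p q (s'.int 8) ∧
      ∀ i < R, s'.int 8 i < n) ∧ Frame .augment s s' := by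
  refine (Runs.while_of_measure (K := 40) (fun s' =>
    Hungarian.Augment n R w p q (s.int 9) (s.int 10) (s'.int 8) (s'.int 6 0) ∧
      Frame .augment s s') (fun s' => s.int 10 (s'.int 6 0)) ?_ ?_).mono ?_ ?_
  · exact ⟨h, Frame.refl _ _⟩
  · rintro s₁ ⟨h₁, hF⟩ hb
    simp only [Test.Holds, IntExpr.eval_var, hF.int 0 rfl, hn, not_le] at hb
    refine (Runs.of_wp (Q := fun s' => s'.int 6 0 = s₁.int 8 (s.int 9 (s₁.int 6 0)) ∧
      s'.int 8 (s.int 9 (s₁.int 6 0)) = s₁.int 6 0 ∧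
      ∀ i, i ≠ s.int 9 (s₁.int 6 0) → s'.int 8 i = s₁.int 8 i) (by decide) ?_).frame.mono le_rfl ?_
    · simp +contextual [Prog.letInt, Prog.wp, IntExpr.eval, hF.int 9 rfl]
    · rintro s₂ ⟨⟨h6, h8, h8'⟩, hF₂⟩
      have := h₁.step hb h8 h8'
      rw [h6]
      exact ⟨⟨this.1, hF.trans (hF₂.mono (fun _ => id) fun _ => id)⟩, this.2⟩
  · simp only [Test.cost, IntExpr.cost, var]
    exact Nat.add_le_add (Nat.mul_le_mul hr (by omega)) (by omega)
  · rintro s' ⟨⟨h', hF⟩, hb⟩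
    simp only [Test.Holds, IntExpr.eval_var, hF.int 0 rfl, hn, not_not] at hb
    exact ⟨⟨h'.toPartial, fun i hi => lt_of_le_of_ne (h'.le i hi) (fun he =>
      h'.free i hi (he.trans (le_antisymm hb h'.hole_le)))⟩, hF⟩

theorem runs_phase {s : State} {n r : ℕ} (hn : s.int 0 0 = n) (hr : s.int 2 0 = r)
    (hrn : r < n) (h : MatchedAt n r s) :
    Runs .phase s ((n + 2) * (n * 279 + 110) + n * 400 + 300)
      fun s' => MatchedAt n (r + 1) s' := by
  refine Runs.mono (Runs.seq (K := n * 93 + 60)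
    (L := ((n + 2) * (n * 279 + 110) + 10) + (n * 300 + 200)) ?_) (by omega) fun _ => id
  refine (runs_initSearch hn hr hrn h).mono le_rfl ?_
  rintro s₁ ⟨⟨h5, h12, hP, hS⟩, hF₁⟩
  have n1 : s₁.int 0 0 = n := by rw [hF₁.int 0 rfl, hn]
  refine Runs.seq ((runs_search n1 h5 hrn hP.le hP.inj ?_ h12 hS).mono le_rfl ?_)
  · intro i hi j hj
    have := hP.feas i (by omega) j hj
    simp only [State.redCost]
    linarith
  rintro s₂ ⟨hfound, hF₂⟩
  have n2 : s₂.int 0 0 = n := by rw [hF₂.int 0 rfl, n1]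
  refine Runs.mono (Runs.seq (K := n * 93 + 10) (L := n * 200 + 190) ?_) (by omega) fun _ => id
  refine (runs_updateColumns n2).mono le_rfl ?_
  rintro s₃ ⟨hq, hF₃⟩
  refine Runs.mono (Runs.seq (K := n * 93 + 110) (L := n * 100 + 80) ?_) (by omega) fun _ => id
  have h53 : s₃.int 5 0 = r + 1 := by rw [hF₃.int 5 rfl, hF₂.int 5 rfl, h5]
  refine (runs_updateRows h53).mono (by omega) ?_
  rintro s₄ ⟨⟨hp1, hp2⟩, hF₄⟩
  have n4 : s₄.int 0 0 = n := by rw [hF₄.int 0 rfl, hF₃.int 0 rfl, n2]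
  have w2 : s₂.weight = s₁.weight := weight_eq_of_real (hF₂.real 9 rfl) (hF₂.real 0 rfl)
  have w4 : s₄.weight = s₂.weight := weight_eq_of_real
    ((hF₄.real 9 rfl).trans (hF₃.real 9 rfl)) ((hF₄.real 0 rfl).trans (hF₃.real 0 rfl))
  have hP2 : PartialAt n (r + 1) s₂ := by
    unfold PartialAt
    rw [w2, hF₂.real 7 rfl, hF₂.real 8 rfl, hF₂.int 8 rfl]
    exact hP
  have hA : Hungarian.Augment n (r + 1) s₂.weight (fun i => s₄.real 7 i 0)
      (fun j => s₄.real 8 j 0) (s₄.int 9) (s₄.int 10) (s₄.int 8) (s₄.int 6 0) := by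
    rw [hF₄.int 9 rfl, hF₄.int 10 rfl, hF₄.int 8 rfl, hF₄.int 6 rfl,
      hF₃.int 9 rfl, hF₃.int 10 rfl, hF₃.int 8 rfl, hF₃.int 6 rfl, hF₄.real 8 rfl]
    refine Hungarian.Settling.augment hP2 hfound.1 hfound.2 hq (fun i hi => ?_) (fun i hi => ?_)
    · rw [hp1 i hi, hF₃.real 7 rfl, hF₃.real 10 rfl, hF₃.real 11 rfl, hF₃.int 8 rfl]
    · rw [hp2 i hi, hF₃.real 7 rfl]
  refine (runs_augment n4 hA ?_).mono (by omega) ?_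
  · rw [hF₄.int 10 rfl, hF₄.int 6 rfl, hF₃.int 10 rfl, hF₃.int 6 rfl]
    exact (hfound.1.rank_le _ hfound.1.lt.le).trans hfound.1.card_le
  · rintro s₅ ⟨h', hF₅⟩
    unfold MatchedAt PartialAt
    rw [weight_eq_of_real (hF₅.real 9 rfl) (hF₅.real 0 rfl), w4, hF₅.real 7 rfl, hF₅.real 8 rfl]
    exact h'

theorem runs_hungarian {s : State} {n : ℕ} (hn : s.int 0 0 = n) (h : MatchedAt n 0 s) :
    Runs .hungarian s (n * ((n + 2) * (n * 279 + 110) + n * 400 + 300 + 13) + 10)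
      fun s' => MatchedAt n n s' ∧ Frame .hungarian s s' := by
  refine Runs.forLoop (N := n) (fun r s' => MatchedAt n r s') hn (by decide) rfl rfl ?_ ?_
  · exact h
  · intro r hr s' hF h2 hI
    exact runs_phase (by rw [hF.int 0 rfl, hn]) h2 hr hI

end RealRAM

/-! ### The quadratic extension of the logarithm -/

/-- The derivative of `quadLog z₀`. -/
noncomputable def quadLogDeriv (z₀ z : ℝ) : ℝ := if z ≤ z₀ then 1 / z₀ - (z - z₀) / z₀ ^ 2 else 1 / z

section quadLog

variable {z₀ : ℝ}

theorem quadLogDeriv_pos (h : 0 < z₀) (z : ℝ) : 0 < quadLogDeriv z₀ z := by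
  unfold quadLogDeriv
  split_ifs with hz
  · have : (z - z₀) / z₀ ^ 2 ≤ 0 := div_nonpos_of_nonpos_of_nonneg (by linarith) (by positivity)
    have : 0 < 1 / z₀ := by positivity
    linarith
  · have : 0 < z := by linarith
    positivity

theorem hasDerivAt_quadLog (h : 0 < z₀) (z : ℝ) :
    HasDerivAt (quadLog z₀) (quadLogDeriv z₀ z) z := by
  have hpoly : HasDerivAt (fun z => Real.log z₀ + (z - z₀) * (1 / z₀) -
      1 / 2 * (z - z₀) ^ 2 * (1 / z₀ ^ 2)) (1 / z₀ - (z - z₀) / z₀ ^ 2) z := by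
    have h1 : HasDerivAt (fun z : ℝ => z - z₀) 1 z := (hasDerivAt_id z).sub_const z₀
    have h2 := ((h1.mul_const (1 / z₀)).const_add (Real.log z₀)).sub
      (((h1.pow 2).const_mul (1 / 2 : ℝ)).mul_const (1 / z₀ ^ 2))
    refine h2.congr_deriv ?_
    simp
    ring
  rcases lt_trichotomy z z₀ with hz | rfl | hz
  · rw [quadLogDeriv, if_pos hz.le]
    refine hpoly.congr_of_eventuallyEq ?_
    filter_upwards [eventually_lt_nhds hz] with y hy
    rw [quadLog, if_pos hy.le]
  -- At the threshold both pieces have value `log z₀` and slope `1 / z₀`, so the one-sided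
  -- derivatives agree.
  · have hl : HasDerivWithinAt (quadLog z) (1 / z) (Set.Iic z) z := by
      have := hpoly.hasDerivWithinAt (s := Set.Iic z)
      rw [sub_self, zero_div, sub_zero] at this
      refine this.congr_of_mem (fun y hy => ?_) Set.self_mem_Iic
      exact if_pos (Set.mem_Iic.mp hy)
    have hr : HasDerivWithinAt (quadLog z) (1 / z) (Set.Ici z) z := by
      have : HasDerivWithinAt Real.log (1 / z) (Set.Ici z) z := by
        simpa using (Real.hasDerivAt_log h.ne').hasDerivWithinAt
      refine this.congr_of_mem (fun y hy => ?_) Set.self_mem_Ici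
      rcases (Set.mem_Ici.mp hy).eq_or_lt with rfl | hy'
      · simp [quadLog]
      · rw [quadLog, if_neg hy'.not_ge]
    have := hl.union hr
    rw [Set.Iic_union_Ici, hasDerivWithinAt_univ] at this
    simpa [quadLogDeriv] using this
  · rw [quadLogDeriv, if_neg hz.not_ge, one_div]
    refine (Real.hasDerivAt_log (h.trans hz).ne').congr_of_eventuallyEq ?_
    filter_upwards [eventually_gt_nhds hz] with y hy
    rw [quadLog, if_neg hy.not_ge]

theorem continuous_quadLog (h : 0 < z₀) : Continuous (quadLog z₀) :=
  continuous_iff_continuousAt.mpr fun z => (hasDerivAt_quadLog h z).continuousAt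

theorem quadLogDeriv_antitone (h : 0 < z₀) : Antitone (quadLogDeriv z₀) := by
  have hle : ∀ z, z ≤ z₀ → 1 / z₀ ≤ quadLogDeriv z₀ z := by
    intro z hz
    rw [quadLogDeriv, if_pos hz]
    have : (z - z₀) / z₀ ^ 2 ≤ 0 := div_nonpos_of_nonpos_of_nonneg (by linarith) (by positivity)
    linarith
  intro a b hab
  rcases le_or_gt b z₀ with hb | hb
  · rw [quadLogDeriv, quadLogDeriv, if_pos hb, if_pos (hab.trans hb)]
    gcongr
  · rcases le_or_gt a z₀ with ha | ha
    · refine le_trans ?_ (hle a ha)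
      rw [quadLogDeriv, if_neg hb.not_ge]
      exact one_div_le_one_div_of_le h hb.le
    · rw [quadLogDeriv, quadLogDeriv, if_neg hb.not_ge, if_neg ha.not_ge]
      exact one_div_le_one_div_of_le (h.trans ha) hab

/-- One half of the Lipschitz bound for η', in a form to which the tangent lemma applies. Below `z₀`
the sum is constant; above it, 1/a − 1/b = (b − a)/(ab) ≤ (b − a)/z₀². -/
theorem quadLogDeriv_add_monotone (h : 0 < z₀) :
    Monotone fun z => quadLogDeriv z₀ z + z / z₀ ^ 2 := by
  have hle : ∀ z, z ≤ z₀ → quadLogDeriv z₀ z + z / z₀ ^ 2 = 1 / z₀ + z₀ / z₀ ^ 2 := by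
    intro z hz
    rw [quadLogDeriv, if_pos hz]
    ring
  have hgt : ∀ a b, z₀ ≤ a → a ≤ b → 1 / a + a / z₀ ^ 2 ≤ 1 / b + b / z₀ ^ 2 := by
    intro a b ha hab
    have ha0 := h.trans_le ha
    have hb0 := ha0.trans_le hab
    have h1 : 1 / a - 1 / b = (b - a) / (a * b) := by field_simp
    have h2 : (b - a) / (a * b) ≤ (b - a) / z₀ ^ 2 := by
      apply div_le_div_of_nonneg_left (by linarith) (by positivity)
      nlinarith
    have h3 : (b - a) / z₀ ^ 2 = b / z₀ ^ 2 - a / z₀ ^ 2 := sub_div _ _ _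
    linarith
  intro a b hab
  simp only
  rcases le_or_gt b z₀ with hb | hb
  · rw [hle b hb, hle a (hab.trans hb)]
  · rw [show quadLogDeriv z₀ b = 1 / b by rw [quadLogDeriv, if_neg hb.not_ge]]
    rcases le_or_gt a z₀ with ha | ha
    · rw [hle a ha]
      exact hgt z₀ b le_rfl hb.le
    · rw [show quadLogDeriv z₀ a = 1 / a by rw [quadLogDeriv, if_neg ha.not_ge]]
      exact hgt a b ha.le hab

/-- A function with decreasing derivative lies below its tangents. -/
theorem le_tangent_of_antitone_deriv {f f' : ℝ → ℝ} (hf : ∀ x, HasDerivAt f (f' x) x)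
    (hf' : Antitone f') (a b : ℝ) : f b ≤ f a + f' a * (b - a) := by
  have hc : Continuous f := continuous_iff_continuousAt.mpr fun x => (hf x).continuousAt
  rcases lt_trichotomy a b with hab | rfl | hab
  · obtain ⟨c, hc, he⟩ := exists_hasDerivAt_eq_slope f f' hab hc.continuousOn fun x _ => hf x
    have h1 : f b - f a = f' c * (b - a) := by
      rw [he, div_mul_cancel₀]; linarith
    nlinarith [hf' hc.1.le]
  · simp
  · obtain ⟨c, hc, he⟩ := exists_hasDerivAt_eq_slope f f' hab hc.continuousOn fun x _ => hf x
    have h1 : f a - f b = f' c * (a - b) := by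
      rw [he, div_mul_cancel₀]; linarith
    nlinarith [hf' hc.2.le]

theorem quadLog_le (h : 0 < z₀) (a b : ℝ) :
    quadLog z₀ b ≤ quadLog z₀ a + quadLogDeriv z₀ a * (b - a) :=
  le_tangent_of_antitone_deriv (hasDerivAt_quadLog h) (quadLogDeriv_antitone h) a b

/-- Apply the tangent inequality to the concave function −(η + z²/(2z₀²)). -/
theorem le_quadLog (h : 0 < z₀) (a b : ℝ) : quadLog z₀ a + quadLogDeriv z₀ a * (b - a) -
    (b - a) ^ 2 / (2 * z₀ ^ 2) ≤ quadLog z₀ b := by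
  have := le_tangent_of_antitone_deriv (f := fun z => -(quadLog z₀ z + z ^ 2 / (2 * z₀ ^ 2)))
    (f' := fun z => -(quadLogDeriv z₀ z + z / z₀ ^ 2)) (fun z => ?_)
    (quadLogDeriv_add_monotone h).neg a b
  · have e : (b - a) ^ 2 / (2 * z₀ ^ 2) =
        b ^ 2 / (2 * z₀ ^ 2) - a ^ 2 / (2 * z₀ ^ 2) - a / z₀ ^ 2 * (b - a) := by
      field_simp
      ring
    linarith
  · refine ((hasDerivAt_quadLog h z).add
      (((hasDerivAt_id z).pow 2).div_const (2 * z₀ ^ 2))).neg.congr_deriv ?_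
    simp
    field_simp

end quadLog

/-! ### Linear maximisation over fractional matchings -/

section Matching

variable {n : ℕ}

/-- Every fractional matching is dominated by a doubly stochastic matrix. -/
theorem exists_doublyStochastic_ge {z : Matrix (Fin n) (Fin n) ℝ} (hz : z ∈ allocations n) :
    ∃ d ∈ doublyStochastic ℝ (Fin n), ∀ i j, z i j ≤ d i j := by
  obtain ⟨h0, hcol, hrow⟩ := hz
  set r : Fin n → ℝ := fun i => 1 - ∑ j, z i j with hr
  set s : Fin n → ℝ := fun j => 1 - ∑ i, z i j with hs
  have hr0 : ∀ i, 0 ≤ r i := fun i => by simp only [hr]; linarith [hrow i]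
  have hs0 : ∀ j, 0 ≤ s j := fun j => by simp only [hs]; linarith [hcol j]
  have hrs : ∑ i, r i = ∑ j, s j := by
    simp only [hr, hs, Finset.sum_sub_distrib]
    rw [Finset.sum_comm]
  have hrS : ∀ i, r i * (∑ j, s j) / (∑ j, s j) = r i := by
    intro i
    by_cases hS : ∑ j, s j = 0
    · rw [hS, mul_zero, zero_div]
      rw [← hrs] at hS
      exact ((Finset.sum_eq_zero_iff_of_nonneg fun i _ => hr0 i).mp hS i (Finset.mem_univ i)).symm
    · rw [mul_div_cancel_right₀ _ hS]
  have hsS : ∀ j, (∑ i, r i) * s j / (∑ j, s j) = s j := by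
    intro j
    by_cases hS : ∑ j, s j = 0
    · rw [hS, div_zero]
      exact ((Finset.sum_eq_zero_iff_of_nonneg fun i _ => hs0 i).mp hS j (Finset.mem_univ j)).symm
    · rw [hrs, mul_div_cancel_left₀ _ hS]
  -- The rank-one correction distributes the row deficits `r` in proportion to the column deficits
  -- `s`. If the total deficit is 0, all deficits vanish and Lean's division by zero gives the right
  -- value 0.
  refine ⟨Matrix.of fun i j => z i j + r i * s j / ∑ j, s j, ?_, fun i j => ?_⟩
  · rw [mem_doublyStochastic_iff_sum]
    refine ⟨fun i j => ?_, fun i => ?_, fun j => ?_⟩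
    · exact add_nonneg (h0 i j)
        (div_nonneg (mul_nonneg (hr0 i) (hs0 j)) (Finset.sum_nonneg fun j _ => hs0 j))
    · simp only [Matrix.of_apply, Finset.sum_add_distrib]
      rw [← Finset.sum_div, ← Finset.mul_sum, hrS]
      simp [hr]
    · simp only [Matrix.of_apply, Finset.sum_add_distrib]
      rw [← Finset.sum_div, ← Finset.sum_mul, hsS]
      simp [hs]
  · exact le_add_of_nonneg_right
      (div_nonneg (mul_nonneg (hr0 i) (hs0 j)) (Finset.sum_nonneg fun j _ => hs0 j))

theorem isMatchingMatrix_of_injective {f : Fin n → Fin n} (hf : Function.Injective f) :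
    IsMatchingMatrix (Matrix.of fun i j => if f i = j then (1 : ℝ) else 0) := by
  refine ⟨⟨fun i j => ?_, fun j => ?_, fun i => ?_⟩, fun i j => ?_⟩
  · simp only [Matrix.of_apply]; split_ifs <;> norm_num
  · obtain ⟨i₀, rfl⟩ := (Finite.injective_iff_surjective.mp hf) j
    simp [hf.eq_iff]
  · simp
  · simp only [Matrix.of_apply]; split_ifs <;> simp

/-- A matching of maximum weight is optimal among the fractional matchings. -/
theorem IsMaxWeightMatching.le {w y z : Matrix (Fin n) (Fin n) ℝ} (hy : IsMaxWeightMatching w y)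
    (hw : ∀ i j, 0 ≤ w i j) (hz : z ∈ allocations n) :
    ∑ i, ∑ j, w i j * z i j ≤ ∑ i, ∑ j, w i j * y i j := by
  -- Nonnegative weights allow passing to a dominating doubly stochastic matrix, which is a convex
  -- combination of permutation matrices.
  obtain ⟨d, hd, hzd⟩ := exists_doublyStochastic_ge hz
  obtain ⟨a, ha0, ha1, rfl⟩ := exists_eq_sum_perm_of_mem_doublyStochastic hd
  calc ∑ i, ∑ j, w i j * z i j
      ≤ ∑ i, ∑ j, w i j * (∑ σ, a σ • σ.permMatrix ℝ) i j := by
        gcongr with i _ j _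
        · exact hw i j
        · exact hzd i j
    _ = ∑ σ, a σ * ∑ i, ∑ j, w i j * σ.permMatrix ℝ i j := by
        simp only [Matrix.sum_apply, Matrix.smul_apply, smul_eq_mul, Finset.mul_sum]
        rw [Finset.sum_comm (s := (Finset.univ : Finset (Equiv.Perm (Fin n))))]
        refine Finset.sum_congr rfl fun i _ => ?_
        rw [Finset.sum_comm]
        exact Finset.sum_congr rfl fun σ _ => Finset.sum_congr rfl fun j _ => by ring
    _ ≤ ∑ σ, a σ * ∑ i, ∑ j, w i j * y i j := by
        refine Finset.sum_le_sum fun σ _ => mul_le_mul_of_nonneg_left ?_ (ha0 σ)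
        refine le_trans (le_of_eq ?_) (hy.2 _ (isMatchingMatrix_of_injective σ.injective))
        refine Finset.sum_congr rfl fun i _ => Finset.sum_congr rfl fun j _ => ?_
        simp [Equiv.Perm.permMatrix, PEquiv.toMatrix_apply, Equiv.toPEquiv_apply, eq_comm]
    _ = ∑ i, ∑ j, w i j * y i j := by rw [← Finset.sum_mul, ha1, one_mul]

/-- A matching along tight edges of a dual feasible solution has maximum weight. -/
theorem isMaxWeightMatching_of_potentials {w : Matrix (Fin n) (Fin n) ℝ} (hw : ∀ i j, 0 ≤ w i j)
    {f : Fin n → Fin n} (hf : Function.Injective f) {p q : Fin n → ℝ}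
    (hfeas : ∀ i j, w i j ≤ p i + q j) (htight : ∀ i, w i (f i) = p i + q (f i)) :
    IsMaxWeightMatching w (Matrix.of fun i j => if f i = j then (1 : ℝ) else 0) := by
  refine ⟨isMatchingMatrix_of_injective hf, fun z hz => ?_⟩
  -- Row and column sums become exactly one, so potentials of either sign give the dual bound.
  obtain ⟨d, hd, hzd⟩ := exists_doublyStochastic_ge hz.1
  obtain ⟨hd0, hdr, hdc⟩ := mem_doublyStochastic_iff_sum.mp hd
  calc ∑ i, ∑ j, w i j * z i j
      ≤ ∑ i, ∑ j, (p i + q j) * d i j := by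
        refine Finset.sum_le_sum fun i _ => Finset.sum_le_sum fun j _ => ?_
        exact (mul_le_mul_of_nonneg_left (hzd i j) (hw i j)).trans
          (mul_le_mul_of_nonneg_right (hfeas i j) (hd0 i j))
    _ = ∑ i, p i + ∑ j, q j := by
        simp only [add_mul, Finset.sum_add_distrib]
        congr 1
        · simp [← Finset.mul_sum, hdr]
        · rw [Finset.sum_comm]
          simp [← Finset.mul_sum, hdc]
    _ = ∑ i, ∑ j, w i j * (Matrix.of fun i j => if f i = j then (1 : ℝ) else 0) i j := by
        simp only [Matrix.of_apply, mul_ite, mul_one, mul_zero, Finset.sum_ite_eq,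
          Finset.mem_univ, if_true, htight, Finset.sum_add_distrib]
        rw [(Finite.injective_iff_bijective.mp hf).sum_comp q]

end Matching

/-! ### Convergence of the conditional gradient algorithm -/

theorem zero_mem_allocations (n : ℕ) : (0 : Matrix (Fin n) (Fin n) ℝ) ∈ allocations n := by
  simp [allocations]

theorem convex_allocations (n : ℕ) : Convex ℝ (allocations n) := by
  rintro x ⟨hx0, hxc, hxr⟩ y ⟨hy0, hyc, hyr⟩ a b ha hb hab
  refine ⟨fun i j => ?_, fun j => ?_, fun i => ?_⟩
  · exact add_nonneg (mul_nonneg ha (hx0 i j)) (mul_nonneg hb (hy0 i j))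
  · simp only [Matrix.add_apply, Matrix.smul_apply, smul_eq_mul, Finset.sum_add_distrib,
      ← Finset.mul_sum]
    nlinarith [hxc j, hyc j]
  · simp only [Matrix.add_apply, Matrix.smul_apply, smul_eq_mul, Finset.sum_add_distrib,
      ← Finset.mul_sum]
    nlinarith [hxr i, hyr i]

theorem isCompact_allocations (n : ℕ) : IsCompact (allocations n) := by
  have hK : IsCompact (Set.univ.pi fun _ : Fin n => Set.univ.pi fun _ : Fin n =>
      Set.Icc (0 : ℝ) 1) :=
    isCompact_univ_pi fun _ => isCompact_univ_pi fun _ => isCompact_Icc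
  refine hK.of_isClosed_subset (?_ : IsClosed (allocations n)) ?_
  · simp only [allocations, Set.ofPred_and, Set.ofPred_forall]
    refine IsClosed.inter ?_ (IsClosed.inter ?_ ?_)
    · exact isClosed_iInter fun i => isClosed_iInter fun j =>
        isClosed_le continuous_const (continuous_id.matrix_elem i j)
    · exact isClosed_iInter fun j => isClosed_le
        (continuous_finsetSum _ fun i _ => continuous_id.matrix_elem i j) continuous_const
    · exact isClosed_iInter fun i => isClosed_le
        (continuous_finsetSum _ fun j _ => continuous_id.matrix_elem i j) continuous_const
  · rintro x ⟨h0, hc, -⟩ i - j -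
    exact ⟨h0 i j, (Finset.single_le_sum (fun i _ => h0 i j) (Finset.mem_univ i)).trans (hc j)⟩

namespace LiAD

variable {n : ℕ} {M : LiAD n}

/-- The threshold below which the logarithm is replaced by its quadratic extension. -/
noncomputable def threshold (M : LiAD n) : ℝ := 1 / (2 * (n : ℝ) ^ 2 * (1 + 1 / M.δ) * M.κ)

/-- The derivative of the summand of the objective that belongs to the agent `i`. -/
noncomputable def slope (M : LiAD n) (x : Matrix (Fin n) (Fin n) ℝ) (i : Fin n) : ℝ :=
  quadLogDeriv M.threshold (M.utility x i - M.c i)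

theorem IsValid.threshold_pos (hM : M.IsValid) (hn : 1 ≤ n) : 0 < M.threshold := by
  have := hM.κ_pos
  have := hM.δ_pos
  have : (0 : ℝ) < n := by exact_mod_cast hn
  unfold threshold
  positivity

theorem IsValid.u_le (hM : M.IsValid) (i j : Fin n) : M.u i j ≤ 1 :=
  (hM.u_max i).2 ⟨j, rfl⟩

/-- From 1/κ ≤ ∑ u_ij ≤ n follows nκ ≥ 1, so the denominator of the threshold is at least 2. -/
theorem IsValid.threshold_le (hM : M.IsValid) (hn : 1 ≤ n) : M.threshold ≤ 1 / 2 := by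
  have hκ := hM.κ_pos
  have hδ := hM.δ_pos
  have hn1 : (1 : ℝ) ≤ n := by exact_mod_cast hn
  have h1 : 1 / M.κ ≤ n := by
    refine (hM.u_sum ⟨0, hn⟩).trans ((Finset.sum_le_sum fun j _ => hM.u_le _ j).trans ?_)
    simp
  have h2 : 1 ≤ n * M.κ := by rwa [div_le_iff₀ hκ] at h1
  have h3 : 0 ≤ 1 / M.δ := by positivity
  unfold threshold
  refine one_div_le_one_div_of_le two_pos ?_
  have h4 : 1 ≤ (n : ℝ) * (n * M.κ) := by nlinarith
  nlinarith [mul_nonneg h3 (by linarith : 0 ≤ (n : ℝ) * (n * M.κ))]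

theorem IsValid.utility_nonneg (hM : M.IsValid) {x : Matrix (Fin n) (Fin n) ℝ}
    (hx : x ∈ allocations n) (i : Fin n) : 0 ≤ M.utility x i :=
  Finset.sum_nonneg fun j _ => mul_nonneg (hM.u_nonneg i j) (hx.1 i j)

theorem IsValid.utility_le (hM : M.IsValid) {x : Matrix (Fin n) (Fin n) ℝ}
    (hx : x ∈ allocations n) (i : Fin n) : M.utility x i ≤ 1 :=
  (Finset.sum_le_sum fun j _ => mul_le_of_le_one_left (hx.1 i j) (hM.u_le i j)).trans (hx.2.2 i)

/-- The feasibility gap enters here: (1 + δ)c_i is at most a utility on P, hence at most 1. -/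
theorem IsValid.c_le (hM : M.IsValid) (i : Fin n) : M.c i ≤ 1 := by
  obtain ⟨x, hx, h⟩ := hM.feasible
  have := (h i).trans (hM.utility_le hx i)
  have := hM.δ_pos
  by_contra hc
  nlinarith

theorem utility_add_smul (M : LiAD n) (x y : Matrix (Fin n) (Fin n) ℝ) (a b : ℝ) (i : Fin n) :
    M.utility (a • x + b • y) i = a * M.utility x i + b * M.utility y i := by
  simp only [utility, Matrix.add_apply, Matrix.smul_apply, smul_eq_mul, Finset.mul_sum,
    ← Finset.sum_add_distrib]
  exact Finset.sum_congr rfl fun j _ => by ring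

/-- The gradient is `u` with its rows rescaled, so the program stores only `n` slopes and recomputes
each weight when needed. -/
theorem IsValid.grad_apply (hM : M.IsValid) (hn : 1 ≤ n) (x : Matrix (Fin n) (Fin n) ℝ)
    (i j : Fin n) : M.grad x i j = M.slope x i * M.u i j := by
  have hu : ∀ k, M.utility (Matrix.single i j 1) k = if k = i then M.u i j else 0 := by
    intro k
    by_cases h : k = i
    · subst h
      simp [utility, Matrix.single_apply]
    · simp [utility, h, Ne.symm h]
  have hline : HasLineDerivAt ℝ M.ψ (∑ k, M.slope x k * M.utility (Matrix.single i j 1) k) x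
      (Matrix.single i j 1) := by
    unfold HasLineDerivAt ψ
    refine HasDerivAt.fun_sum fun k _ => ?_
    have h1 : HasDerivAt (fun t : ℝ => M.utility (x + t • Matrix.single i j 1) k - M.c k)
        (M.utility (Matrix.single i j 1) k) 0 := by
      have : ∀ t : ℝ, M.utility (x + t • Matrix.single i j 1) k =
          M.utility x k + t * M.utility (Matrix.single i j 1) k := fun t => by
        simpa using M.utility_add_smul x (Matrix.single i j 1) 1 t k
      simp only [this]
      simpa using (((hasDerivAt_id (0 : ℝ)).mul_const
        (M.utility (Matrix.single i j 1) k)).const_add (M.utility x k)).sub_const (M.c k)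
    have h2 := (hasDerivAt_quadLog (hM.threshold_pos hn)
      (M.utility (x + (0 : ℝ) • Matrix.single i j 1) k - M.c k))
    have h3 := HasDerivAt.comp (0 : ℝ) h2 h1
    rw [zero_smul, add_zero] at h3
    exact h3
  rw [grad, Matrix.of_apply, hline.lineDeriv]
  simp [hu]

theorem IsValid.grad_nonneg (hM : M.IsValid) (hn : 1 ≤ n) (x : Matrix (Fin n) (Fin n) ℝ)
    (i j : Fin n) : 0 ≤ M.grad x i j := by
  rw [hM.grad_apply hn]
  exact mul_nonneg (quadLogDeriv_pos (hM.threshold_pos hn) _).le (hM.u_nonneg i j)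

theorem IsValid.sum_grad (hM : M.IsValid) (hn : 1 ≤ n) (x y : Matrix (Fin n) (Fin n) ℝ) :
    ∑ i, ∑ j, M.grad x i j * y i j = ∑ i, M.slope x i * M.utility y i := by
  simp only [hM.grad_apply hn, utility, Finset.mul_sum, mul_assoc]

theorem IsValid.ψ_le (hM : M.IsValid) (hn : 1 ≤ n) (x y : Matrix (Fin n) (Fin n) ℝ) :
    M.ψ y ≤ M.ψ x + ∑ i, M.slope x i * (M.utility y i - M.utility x i) := by
  unfold ψ
  rw [← Finset.sum_add_distrib]
  refine Finset.sum_le_sum fun i _ => ?_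
  have := quadLog_le (hM.threshold_pos hn) (M.utility x i - M.c i) (M.utility y i - M.c i)
  rw [sub_sub_sub_cancel_right] at this
  exact this

/-- The curvature of the objective. -/
noncomputable def curvature (M : LiAD n) : ℝ := n / M.threshold ^ 2

theorem IsValid.le_ψ (hM : M.IsValid) (hn : 1 ≤ n) {x y : Matrix (Fin n) (Fin n) ℝ}
    (hx : x ∈ allocations n) (hy : y ∈ allocations n) (γ : ℝ) :
    M.ψ x + γ * ∑ i, M.slope x i * (M.utility y i - M.utility x i) - γ ^ 2 * M.curvature / 2 ≤
      M.ψ ((1 - γ) • x + γ • y) := by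
  have ht := hM.threshold_pos hn
  have hc : γ ^ 2 * M.curvature / 2 = ∑ i : Fin n, γ ^ 2 / (2 * M.threshold ^ 2) := by
    rw [Finset.sum_const, Finset.card_univ, Fintype.card_fin, nsmul_eq_mul, curvature]
    field_simp
  unfold ψ
  rw [hc, Finset.mul_sum, ← Finset.sum_add_distrib, ← Finset.sum_sub_distrib]
  refine Finset.sum_le_sum fun i _ => ?_
  have h := le_quadLog ht (M.utility x i - M.c i) (M.utility ((1 - γ) • x + γ • y) i - M.c i)
  rw [sub_sub_sub_cancel_right, utility_add_smul] at h
  rw [utility_add_smul]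
  have e : (1 - γ) * M.utility x i + γ * M.utility y i - M.utility x i =
      γ * (M.utility y i - M.utility x i) := by ring
  rw [e] at h
  have hsq : (M.utility y i - M.utility x i) ^ 2 ≤ 1 := by
    rw [sq_le_one_iff_abs_le_one, abs_le]
    constructor <;> linarith [hM.utility_nonneg hx i, hM.utility_nonneg hy i, hM.utility_le hx i,
      hM.utility_le hy i]
  have hq : (γ * (M.utility y i - M.utility x i)) ^ 2 / (2 * M.threshold ^ 2) ≤
      γ ^ 2 / (2 * M.threshold ^ 2) := by
    rw [mul_pow]
    exact div_le_div_of_nonneg_right (mul_le_of_le_one_right (sq_nonneg γ) hsq) (by positivity)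
  refine le_trans (le_of_eq_of_le ?_ (sub_le_sub_left hq _)) h
  simp only [slope, threshold]
  ring

theorem IsIteration.mem {t : ℕ} (ht : 1 ≤ t)
    {x x' : Matrix (Fin n) (Fin n) ℝ} (hx : x ∈ allocations n) (h : M.IsIteration t x x') :
    x' ∈ allocations n := by
  obtain ⟨y, hy, rfl⟩ := h
  have ht' : (1 : ℝ) ≤ t := by exact_mod_cast ht
  refine convex_allocations n hx hy.1.1 ?_ (by positivity) (by ring)
  rw [sub_nonneg, div_le_one (by positivity)]
  linarith

/-- By concavity the gap at `x` is at most the linear gain towards `z`, hence at most that towards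
the matching `y`. A step γ realises γ times this gain up to the curvature error. -/
theorem IsIteration.gap_le (hM : M.IsValid) (hn : 1 ≤ n) {t : ℕ} (ht : 1 ≤ t)
    {x x' z : Matrix (Fin n) (Fin n) ℝ} (hx : x ∈ allocations n) (hz : z ∈ allocations n)
    (h : M.IsIteration t x x') :
    M.ψ z - M.ψ x' ≤ (1 - 2 / ((t : ℝ) + 1)) * (M.ψ z - M.ψ x) +
      (2 / ((t : ℝ) + 1)) ^ 2 * M.curvature / 2 := by
  obtain ⟨y, hy, rfl⟩ := h
  have h1 := hM.ψ_le hn x z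
  have h2 := hM.le_ψ hn hx hy.1.1 (2 / ((t : ℝ) + 1))
  have h3 := hy.le (hM.grad_nonneg hn x) hz
  rw [hM.sum_grad hn, hM.sum_grad hn] at h3
  simp only [mul_sub, Finset.sum_sub_distrib] at h1 h2
  have hγ : (0 : ℝ) ≤ 2 / ((t : ℝ) + 1) := by positivity
  nlinarith

/-- Base of the induction. It also covers runs with `T = 0`, which the floor permits when ε is
large. -/
theorem IsValid.gap_zero_le (hM : M.IsValid) (hn : 1 ≤ n) {z : Matrix (Fin n) (Fin n) ℝ}
    (hz : z ∈ allocations n) : M.ψ z - M.ψ 0 ≤ 2 * M.curvature := by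
  have h1 := hM.ψ_le hn 0 z
  have ht := hM.threshold_pos hn
  have ht' := hM.threshold_le hn
  have hs : ∀ i, M.slope 0 i ≤ 2 / M.threshold ^ 2 := by
    intro i
    have h0 : M.utility 0 i = 0 := by simp [utility]
    -- The minimum is just −1. There η' equals (1 + 2z₀)/z₀², at most 2/z₀² because z₀ ≤ 1/2.
    have hm : min (-1) M.threshold ≤ M.utility 0 i - M.c i := by
      refine (min_le_left _ _).trans ?_
      linarith [hM.c_le i]
    refine (quadLogDeriv_antitone ht hm).trans ?_
    rw [min_eq_left (by linarith), quadLogDeriv, if_pos (by linarith)]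
    have : 1 / M.threshold = M.threshold / M.threshold ^ 2 := by field_simp
    rw [this, ← sub_div]
    gcongr
    linarith
  have h2 : ∑ i, M.slope 0 i * (M.utility z i - M.utility 0 i) ≤
      ∑ _i : Fin n, 2 / M.threshold ^ 2 := by
    refine Finset.sum_le_sum fun i _ => ?_
    have h0 : M.utility 0 i = 0 := by simp [utility]
    rw [h0, sub_zero]
    exact (mul_le_of_le_one_right (quadLogDeriv_pos ht _).le (hM.utility_le hz i)).trans (hs i)
  have h3 : ∑ _i : Fin n, 2 / M.threshold ^ 2 = 2 * M.curvature := by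
    rw [Finset.sum_const, Finset.card_univ, Fintype.card_fin, nsmul_eq_mul, curvature]
    ring
  linarith

theorem IsRun.mem {T : ℕ} {x : ℕ → Matrix (Fin n) (Fin n) ℝ}
    (h : M.IsRun T x) : ∀ t ≤ T, x t ∈ allocations n := by
  intro t
  induction t with
  | zero => intro _; rw [h.1]; exact zero_mem_allocations n
  | succ t ih => exact fun ht => (h.2 t ht).mem (by omega) (ih (by omega))

theorem IsRun.gap_le (hM : M.IsValid) (hn : 1 ≤ n) {T : ℕ} {x : ℕ → Matrix (Fin n) (Fin n) ℝ}
    (h : M.IsRun T x) {z : Matrix (Fin n) (Fin n) ℝ} (hz : z ∈ allocations n) :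
    ∀ t ≤ T, M.ψ z - M.ψ (x t) ≤ 2 * M.curvature / (t + 1) := by
  have hB : 0 ≤ M.curvature := by unfold curvature; positivity
  intro t
  induction t with
  | zero =>
    intro _
    rw [h.1]
    simpa using hM.gap_zero_le hn hz
  | succ t ih =>
    intro ht
    refine ((h.2 t ht).gap_le hM hn (by omega) (h.mem t (by omega)) hz).trans ?_
    have h1 := ih (by omega)
    push_cast
    have ht0 : (0 : ℝ) ≤ t := t.cast_nonneg
    have hγ : (0 : ℝ) ≤ 1 - 2 / (t + 1 + 1) := by
      rw [sub_nonneg, div_le_one (by positivity)]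
      linarith
    refine (add_le_add_left (mul_le_mul_of_nonneg_left h1 hγ) _).trans ?_
    -- The slack of the induction step, in closed form and visibly nonnegative.
    have e : 2 * M.curvature / ((t : ℝ) + 1 + 1) - ((1 - 2 / ((t : ℝ) + 1 + 1)) *
        (2 * M.curvature / (t + 1)) + (2 / ((t : ℝ) + 1 + 1)) ^ 2 * M.curvature / 2) =
        2 * M.curvature / ((t + 1) * (t + 1 + 1) ^ 2) := by
      field_simp
      ring
    have : 0 ≤ 2 * M.curvature / (((t : ℝ) + 1) * (t + 1 + 1) ^ 2) := by positivity
    linarith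

theorem IsValid.exists_isOptimum (hM : M.IsValid) (hn : 1 ≤ n) : ∃ x, M.IsOptimum x := by
  have hc : Continuous M.ψ := by
    unfold ψ
    refine continuous_finsetSum _ fun i _ => (continuous_quadLog (hM.threshold_pos hn)).comp ?_
    exact (continuous_finsetSum _ fun j _ =>
      continuous_const.mul (continuous_id.matrix_elem i j)).sub continuous_const
  obtain ⟨x, hx, h⟩ := (isCompact_allocations n).exists_isMaxOn ⟨0, zero_mem_allocations n⟩
    hc.continuousOn
  exact ⟨x, hx, h⟩

/-- The floor loses nothing: a real number is less than its floor plus one, and `T + 1` is the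
denominator of the gap bound. The 8 is 2 · 2², from twice the curvature and the squared factor 2 in
1/z₀. -/
theorem IsRun.gap_le_of_floor_le (hM : M.IsValid) (hn : 1 ≤ n) {ε : ℝ} (hε : 0 < ε) {T : ℕ}
    (hT : ⌊8 * ((n : ℝ) ^ 5 * (1 + 1 / M.δ) ^ 2 * M.κ ^ 2 / ε)⌋₊ ≤ T)
    {x : ℕ → Matrix (Fin n) (Fin n) ℝ} (h : M.IsRun T x) {z : Matrix (Fin n) (Fin n) ℝ}
    (hz : z ∈ allocations n) : M.ψ z - M.ψ (x T) ≤ ε := by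
  refine (h.gap_le hM hn hz T le_rfl).trans ?_
  have h1 : 8 * ((n : ℝ) ^ 5 * (1 + 1 / M.δ) ^ 2 * M.κ ^ 2 / ε) < T + 1 := by
    refine (Nat.lt_floor_add_one _).trans_le ?_
    gcongr
  have hκ := hM.κ_pos
  have hδ := hM.δ_pos
  have hn0 : (0 : ℝ) < n := by exact_mod_cast hn
  have h2 : 2 * M.curvature = 8 * ((n : ℝ) ^ 5 * (1 + 1 / M.δ) ^ 2 * M.κ ^ 2) := by
    unfold curvature threshold
    field_simp
    ring
  rw [← mul_div_assoc, div_lt_iff₀ hε] at h1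
  rw [h2, div_le_iff₀ (by positivity)]
  linarith

end LiAD

/-! ### The program for a whole iteration and its running time -/

namespace RealRAM

open IntExpr (var)

namespace Prog

/-- Accumulate the utility of the agent in the row counter. -/
def sumUtility : Prog :=
  forLoop 3 0 <| letReal 6 (.add (.var 6) (.mul (.cell 0 (var 4) (var 3)) (.cell 4 (var 4) (var 3))))

/-- From the utility of an agent, compute the derivative of its summand of the objective, and
initialise the potentials. -/
def setSlope : Prog :=
  .seq (letReal 6 (.sub (.var 6) (.entry 1 (var 4)))) <|
  .seq (.ite (.realLE (.var 6) (.var 5))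
      (.setReal 9 (var 4) (.const 0) (.sub (.div (.ofInt (.const 1)) (.var 5))
        (.div (.sub (.var 6) (.var 5)) (.mul (.var 5) (.var 5)))))
      (.setReal 9 (var 4) (.const 0) (.div (.ofInt (.const 1)) (.var 6)))) <|
  .seq (.setReal 7 (var 4) (.const 0) (.entry 9 (var 4)))
    (.setReal 8 (var 4) (.const 0) (.ofInt (.const 0)))

/-- Compute the threshold of the extended logarithm. -/
def setThreshold : Prog :=
  letReal 5 (.div (.ofInt (.const 1)) (.mul (.mul (.mul (.ofInt (.const 2))
    (.mul (.ofInt (var 0)) (.ofInt (var 0))))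
    (.add (.ofInt (.const 1)) (.div (.ofInt (.const 1)) (.var 2)))) (.var 3)))

/-- Compute the derivatives of the summands of the objective. -/
def setSlopes : Prog :=
  .seq setThreshold <| forLoop 4 0 <|
    .seq (letReal 6 (.ofInt (.const 0))) <| .seq sumUtility setSlope

/-- Move the iterate towards the matching. -/
def updateIterate : Prog :=
  .seq (letReal 6 (.div (.ofInt (.const 2)) (.ofInt (.add (var 1) (.const 1))))) <|
  forLoop 4 0 <|
    .seq (forLoop 3 0 <| .setReal 4 (var 4) (var 3)
      (.mul (.sub (.ofInt (.const 1)) (.var 6)) (.cell 4 (var 4) (var 3)))) <|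
    .setReal 4 (var 4) (.cell 8 (var 4)) (.add (.cell 4 (var 4) (.cell 8 (var 4))) (.var 6))

/-- One iteration of the conditional gradient algorithm. -/
def iteration : Prog :=
  .seq setSlopes <| .seq hungarian <| .seq updateIterate <|
    letInt 1 (.add (var 1) (.const 1))

end Prog

theorem runs_sumUtility {s : State} {n i : ℕ} (hn : s.int 0 0 = n) (hi : s.int 4 0 = i) :
    Runs .sumUtility s (n * 93 + 10) fun s' => s'.real 6 0 0 =
      s.real 6 0 0 + ∑ j ∈ Finset.range n, s.real 0 i j * s.real 4 i j := by
  refine (Runs.forLoop (N := n) (K := 80) (fun m s' => s'.real 6 0 0 =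
    s.real 6 0 0 + ∑ j ∈ Finset.range m, s.real 0 i j * s.real 4 i j) hn (by decide) rfl rfl
      ?_ ?_).mono le_rfl (fun s' h => h.1)
  · simp
  · intro k hk s' hF h3 hI
    apply Runs.of_wp (by decide)
    simp [Prog.wp, Prog.letReal, IntExpr.eval, RealExpr.eval, h3, hF.real 0 rfl, hF.real 4 rfl,
      hF.int 4 rfl, hi, hI, Finset.sum_range_succ, add_assoc]

theorem runs_setSlopes {s : State} {n : ℕ} (hn : s.int 0 0 = n) {z₀ : ℝ}
    (hz₀ : z₀ = 1 / (2 * (n : ℝ) ^ 2 * (1 + 1 / s.real 2 0 0) * s.real 3 0 0)) :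
    Runs .setSlopes s (n * (n * 93 + 200) + 100) fun s' => (∀ i < n, s'.real 9 i 0 =
        quadLogDeriv z₀ (∑ j ∈ Finset.range n, s.real 0 i j * s.real 4 i j - s.real 1 i 0) ∧
      s'.real 7 i 0 = s'.real 9 i 0 ∧ s'.real 8 i 0 = 0) ∧ Frame .setSlopes s s' := by
  apply Runs.frame
  refine Runs.mono (Runs.seq (K := 60) (L := n * (n * 93 + 200) + 10) ?_) (by omega)
    fun _ => id
  refine (Runs.of_wp (Q := fun s' => s'.real 5 0 0 = z₀) (by decide) ?_).frame.mono le_rfl ?_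
  · simp only [Prog.setThreshold, Prog.letReal, Prog.wp, RealExpr.eval, IntExpr.eval,
      IntExpr.eval_var, RealExpr.eval_var, State.real_writeReal, and_self, if_true, hn, hz₀]
    push_cast
    ring
  rintro s₁ ⟨h5, hF₁⟩
  refine (Runs.forLoop (N := n) (K := n * 93 + 187) (fun m s' => ∀ i < m, s'.real 9 i 0 =
        quadLogDeriv z₀ (∑ j ∈ Finset.range n, s.real 0 i j * s.real 4 i j - s.real 1 i 0) ∧
      s'.real 7 i 0 = s'.real 9 i 0 ∧ s'.real 8 i 0 = 0)
      (by rw [hF₁.int 0 rfl, hn]) (by decide) rfl rfl ?_ ?_).mono le_rfl (fun s' h => h.1)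
  · simp
  · intro k hk s₂ hF₂ h4 hI
    refine Runs.mono (Runs.seq (K := 10) (L := n * 93 + 170)
      ((Runs.of_wp (Q := fun s' => s'.real 6 0 0 = 0) (by decide) ?_).frame.mono le_rfl ?_))
      (by omega) fun _ => id
    · simp [Prog.letReal, Prog.wp, RealExpr.eval, IntExpr.eval]
    rintro s₃ ⟨h6, hF₃⟩
    have n3 : s₃.int 0 0 = n := by rw [hF₃.int 0 rfl, hF₂.int 0 rfl, hF₁.int 0 rfl, hn]
    have k3 : s₃.int 4 0 = k := by rw [hF₃.int 4 rfl, h4]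
    refine Runs.mono (Runs.seq (K := n * 93 + 10) (L := 150)
      ((runs_sumUtility n3 k3).frame.mono le_rfl ?_)) (by omega) fun _ => id
    rintro s₄ ⟨h6', hF₄⟩
    rw [h6, zero_add, hF₃.real 0 rfl, hF₃.real 4 rfl, hF₂.real 0 rfl, hF₂.real 4 rfl,
      hF₁.real 0 rfl, hF₁.real 4 rfl] at h6'
    have k4 : s₄.int 4 0 = k := by rw [hF₄.int 4 rfl, k3]
    have e1 : s₄.real 1 = s.real 1 := by
      rw [hF₄.real 1 rfl, hF₃.real 1 rfl, hF₂.real 1 rfl, hF₁.real 1 rfl]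
    have e5 : s₄.real 5 0 0 = z₀ := by
      rw [hF₄.real 5 rfl, hF₃.real 5 rfl, hF₂.real 5 rfl, h5]
    have e7 : s₄.real 7 = s₂.real 7 := by rw [hF₄.real 7 rfl, hF₃.real 7 rfl]
    have e8 : s₄.real 8 = s₂.real 8 := by rw [hF₄.real 8 rfl, hF₃.real 8 rfl]
    have e9 : s₄.real 9 = s₂.real 9 := by rw [hF₄.real 9 rfl, hF₃.real 9 rfl]
    apply Runs.of_wp (by decide)
    simp only [Prog.setSlope, Prog.wp, Prog.letReal, RealExpr.eval, IntExpr.eval, IntExpr.eval_var,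
      RealExpr.eval_var, RealExpr.eval_entry, Test.Holds, State.int_writeReal,
      State.real_writeReal, State.real_writeInt, k4, e1, e5, h6', e7, e8, e9]
    refine ⟨fun hb i hi => ?_, fun hb i hi => ?_⟩ <;> rcases eq_or_ne i k with rfl | hik
    · simp at hb
      simp [quadLogDeriv, hb, sq]
    · simpa [hik] using hI i (by omega)
    · simp at hb
      simp [quadLogDeriv, hb.not_ge]
    · simpa [hik] using hI i (by omega)

/-- Each row is scaled by 1 − γ and then gains γ in its matched column, so the matching matrix is
never stored. -/
theorem runs_updateIterate {s : State} {n : ℕ} (hn : s.int 0 0 = n) {γ : ℝ}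
    (hγ : γ = 2 / ((s.int 1 0 : ℝ) + 1)) :
    Runs .updateIterate s (n * (n * 93 + 100) + 100) fun s' => (∀ i < n, ∀ j < n,
      s'.real 4 i j = (1 - γ) * s.real 4 i j + γ * (if s.int 8 i = j then 1 else 0)) ∧
      Frame .updateIterate s s' := by
  apply Runs.frame
  refine Runs.mono (Runs.seq (K := 60) (L := n * (n * 93 + 100) + 10) ?_) (by omega)
    fun _ => id
  refine (Runs.of_wp (Q := fun s' => s'.real 6 0 0 = γ) (by decide) ?_).frame.mono le_rfl ?_
  · simp [Prog.letReal, Prog.wp, RealExpr.eval, IntExpr.eval, hγ]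
  rintro s₁ ⟨h6, hF₁⟩
  refine (Runs.forLoop (N := n) (K := n * 93 + 87) (fun m s' => (∀ i < m, ∀ j < n,
      s'.real 4 i j = (1 - γ) * s.real 4 i j + γ * (if s.int 8 i = j then 1 else 0)) ∧
      ∀ i, m ≤ i → s'.real 4 i = s.real 4 i)
      (by rw [hF₁.int 0 rfl, hn]) (by decide) rfl rfl ?_ ?_).mono le_rfl (fun s' h => h.1.1)
  · simp [hF₁.real 4 rfl]
  · rintro k hk s₂ hF₂ h4 ⟨hI, hI'⟩
    have n2 : s₂.int 0 0 = n := by rw [hF₂.int 0 rfl, hF₁.int 0 rfl, hn]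
    have e6 : s₂.real 6 0 0 = γ := by rw [hF₂.real 6 rfl, h6]
    refine Runs.mono (Runs.seq (K := n * 93 + 10) (L := 60) ?_) (by omega) fun _ => id
    refine (Runs.forLoop (N := n) (K := 80) (fun m s' =>
      (∀ j < m, s'.real 4 k j = (1 - γ) * s.real 4 k j) ∧
      (∀ j, m ≤ j → s'.real 4 k j = s.real 4 k j) ∧
      ∀ i, i ≠ k → ∀ j, s'.real 4 i j = s₂.real 4 i j) n2 (by decide) rfl rfl ?_ ?_).mono le_rfl ?_
    · simp [hI' k le_rfl]
    · intro m hm s' hF h3 hI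
      apply Runs.of_wp (by decide)
      simp [Prog.wp, RealExpr.eval, IntExpr.eval, h3, hF.int 4 rfl, h4, hF.real 6 rfl, e6]
      grind
    · rintro s₃ ⟨⟨h, -, h'⟩, hF₃⟩
      apply Runs.of_wp (by decide)
      have e8 : s₃.int 8 = s.int 8 := by rw [hF₃.int 8 rfl, hF₂.int 8 rfl, hF₁.int 8 rfl]
      have k3 : s₃.int 4 0 = k := by rw [hF₃.int 4 rfl, h4]
      have e6' : s₃.real 6 0 0 = γ := by rw [hF₃.real 6 rfl, e6]
      simp only [Prog.wp, RealExpr.eval, IntExpr.eval, IntExpr.eval_var, RealExpr.eval_var,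
        State.real_writeReal, State.real_writeInt, e8, k3, e6']
      refine ⟨fun i hi j hj => ?_, fun i hi => ?_⟩
      · rcases eq_or_ne i k with rfl | hik
        · by_cases hj' : s.int 8 i = j
          · simp [hj', h j hj]
          · simp [hj', Ne.symm hj', h j hj]
        · simp only [hik, false_and, and_false, if_false]
          rw [h' i hik]
          exact hI i (by omega) j hj
      · have hik : i ≠ k := by omega
        funext j
        simp only [State.real_writeReal, hik, false_and, and_false, if_false]
        rw [h' i hik, hI' i (by omega)]

end RealRAM

open RealRAM in
theorem LiAD.IsValid.runs_iteration {n : ℕ} {M : LiAD n} (hM : M.IsValid) (hn : 1 ≤ n) {t : ℕ}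
    {x : Matrix (Fin n) (Fin n) ℝ} {s : State} (hs : M.Stored s t x) :
    Runs .iteration s (4000 * n ^ 3)
      fun s' => ∃ x', M.IsIteration t x x' ∧ M.Stored s' (t + 1) x' := by
  have hsl := runs_setSlopes hs.n_eq (z₀ := M.threshold)
    (by rw [hs.δ_eq, hs.κ_eq, LiAD.threshold])
  have hcost : (n * (n * 93 + 200) + 100) +
      ((n * ((n + 2) * (n * 279 + 110) + n * 400 + 300 + 13) + 10) +
        ((n * (n * 93 + 100) + 100) + 20)) ≤ 4000 * n ^ 3 := by
    -- Lower-order terms are absorbed using `n ≥ 1`: after the shift both sides are polynomials in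
    -- `m` with nonnegative coefficients.
    obtain ⟨m, rfl⟩ : ∃ m, n = m + 1 := ⟨n - 1, by omega⟩
    ring_nf
    have : m ≤ m ^ 2 + m ^ 3 := by nlinarith [sq_nonneg m]
    nlinarith [Nat.zero_le (m ^ 2), Nat.zero_le (m ^ 3)]
  refine Runs.mono (Runs.seq (hsl.mono le_rfl ?_)) hcost fun _ => id
  rintro s₁ ⟨h₁, hF₁⟩
  have n1 : s₁.int 0 0 = n := by rw [hF₁.int 0 rfl, hs.n_eq]
  have hslope : ∀ i : Fin n, s₁.real 9 i 0 = M.slope x i := by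
    intro i
    rw [(h₁ i i.2).1, LiAD.slope, LiAD.utility, hs.c_eq, Finset.sum_range]
    simp only [hs.u_eq, hs.x_eq]
  have hw : ∀ i j : Fin n, s₁.weight i j = M.grad x i j := by
    intro i j
    rw [hM.grad_apply hn, State.weight, hslope, hF₁.real 0 rfl, hs.u_eq]
  have hpos : ∀ i, 0 < M.slope x i := fun i => quadLogDeriv_pos (hM.threshold_pos hn) _
  -- Slopes as row potentials and zero column potentials are dual feasible because u_ij ≤ 1.
  have hmatch : MatchedAt n 0 s₁ := by
    refine ⟨⟨by simp, by simp, fun i hi j hj => ?_, by simp⟩, by simp⟩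
    rw [(h₁ i hi).2.1, (h₁ j hj).2.2, add_zero, hw ⟨i, hi⟩ ⟨j, hj⟩, hM.grad_apply hn,
      hslope ⟨i, hi⟩]
    exact mul_le_of_le_one_right (hpos _).le (hM.u_le _ _)
  refine Runs.seq ((runs_hungarian n1 hmatch).mono le_rfl ?_)
  rintro s₂ ⟨⟨hP, hlt⟩, hF₂⟩
  have n2 : s₂.int 0 0 = n := by rw [hF₂.int 0 rfl, n1]
  have t2 : s₂.int 1 0 = t := by rw [hF₂.int 1 rfl, hF₁.int 1 rfl, hs.t_eq]
  refine Runs.seq ((runs_updateIterate n2 rfl).mono le_rfl ?_)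
  rintro s₃ ⟨h₃, hF₃⟩
  have t3 : s₃.int 1 0 = t := by rw [hF₃.int 1 rfl, t2]
  refine (Runs.of_wp (Q := fun s' => s'.int 1 0 = t + 1) (by decide) ?_).frame.mono le_rfl ?_
  · simp [Prog.letInt, Prog.wp, IntExpr.eval, t3]
  rintro s₄ ⟨t4, hF₄⟩
  set f : Fin n → Fin n := fun i => ⟨s₂.int 8 i, hlt i i.2⟩ with hf
  have hw2 : s₂.weight = s₁.weight := weight_eq_of_real (hF₂.real 9 rfl) (hF₂.real 0 rfl)
  refine ⟨_, ⟨_, isMaxWeightMatching_of_potentials (hM.grad_nonneg hn x) (f := f)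
    (p := fun i => s₂.real 7 i 0) (q := fun j => s₂.real 8 j 0) ?_ ?_ ?_, rfl⟩, ?_⟩
  · intro i j hij
    exact Fin.ext (hP.inj i i.2 j j.2 (by simpa [hf] using hij))
  · intro i j
    rw [← hw, ← hw2]
    exact hP.feas i i.2 j j.2
  · intro i
    rw [← hw, ← hw2]
    exact hP.tight i i.2 (hlt i i.2)
  · have hr : ∀ a < 4, s₄.real a = s.real a := by
      intro a ha
      interval_cases a <;>
        rw [hF₄.real _ rfl, hF₃.real _ rfl, hF₂.real _ rfl, hF₁.real _ rfl]
    refine ⟨by rw [hF₄.int 0 rfl, hF₃.int 0 rfl, n2], t4, fun i j => ?_, fun i => ?_, ?_, ?_,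
      fun i j => ?_⟩
    · rw [hr 0 (by norm_num), hs.u_eq]
    · rw [hr 1 (by norm_num), hs.c_eq]
    · rw [hr 2 (by norm_num), hs.δ_eq]
    · rw [hr 3 (by norm_num), hs.κ_eq]
    · rw [hF₄.real 4 rfl, h₃ i i.2 j j.2, t2, hF₂.real 4 rfl, hF₁.real 4 rfl, hs.x_eq]
      simp [hf, Fin.ext_iff]

theorem mainTheorem5 :
    (∃ C : ℝ, 0 < C ∧ ∀ (n : ℕ) (M : LiAD n), 1 ≤ n → M.IsValid →
      (∃ xs, M.IsOptimum xs) ∧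
      ∀ ε : ℝ, 0 < ε → ∀ T : ℕ,
        ⌊C * ((n : ℝ) ^ 5 * (1 + 1 / M.δ) ^ 2 * M.κ ^ 2 / ε)⌋₊ ≤ T →
        ∀ x : ℕ → Matrix (Fin n) (Fin n) ℝ, M.IsRun T x →
          x T ∈ allocations n ∧ ∀ xs, M.IsOptimum xs → M.ψ xs - M.ψ (x T) ≤ ε) ∧
    (∃ (P : RealRAM.Prog) (C : ℕ), ∀ (n : ℕ) (M : LiAD n), 1 ≤ n → M.IsValid →
      ∀ (t : ℕ), 1 ≤ t → ∀ x ∈ allocations n, ∀ s : RealRAM.State, M.Stored s t x →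
        ∃ (s' : RealRAM.State) (k : ℕ) (x' : Matrix (Fin n) (Fin n) ℝ),
          RealRAM.Exec P s s' k ∧ k ≤ C * n ^ 3 ∧
          M.IsIteration t x x' ∧ M.Stored s' (t + 1) x') := by
  refine ⟨⟨8, by norm_num, fun n M hn hM => ⟨hM.exists_isOptimum hn,
    fun ε hε T hT x hx => ⟨hx.mem T le_rfl, fun xs hxs =>
      hx.gap_le_of_floor_le hM hn hε hT hxs.1⟩⟩⟩, .iteration, 4000, fun n M hn hM t _ x _ s hs => ?_⟩
  obtain ⟨s', k, he, hk, x', hit, hst⟩ := hM.runs_iteration hn hs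
  exact ⟨s', k, x', he, hk, hit, hst⟩
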